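/- Consider a sequence of multiclass many-server queues indexed by the number $n$ of servers, with $m$ customer classes, $\mathcal I=\{1,\dots,m\}$. In the $n$-th system class-$i$ customers arrive according to a Poisson process of rate $\lambda^n_i$, have exponential service times of rate $\mu^n_i$, and abandon the queue after exponential patience times of rate $\gamma^n_i\ge 0$, all independent. Assume the Halfin--Whitt regime: for every $i\in\mathcal I$, as $n\to\infty$, $$\frac{\lambda^n_i}{n}\to\lambda_i>0,\quad \mu^n_i\to\mu_i>0,\quad \gamma^n_i\to\gamma_i\ge 0,\quad \frac{\lambda^n_i-n\lambda_i}{\sqrt n}\to\hat\lambda_i,\quad \sqrt n\,(\mu^n_i-\mu_i)\to\hat\mu_i,$$ with $\rho_i:=\lambda_i/\mu_i<1$ and $\sum_{i}\rho_i=1$. A work-conserving (preemptive) stationary Markov scheduling policy for the $n$-th system is a map $z:\mathbb Z_+^m\to\mathbb Z_+^m$ with $z_i(x)\le x_i$ and $\sum_i z_i(x)=\min(n,\sum_i x_i)$. Under $z$, the process $X^n$ of the numbers of jobs of each class in the system is the Markov jump process on $\mathbb Z_+^m$ that jumps from $x$ to $x+e_i$ at rate $\lambda^n_i$ and from $x$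 to $x-e_i$ at rate $\mu^n_i z_i(x)+\gamma^n_i(x_i-z_i(x))$. Let $$\varrho^n:=\sqrt n\Bigl(1-\sum_{i}\frac{\lambda^n_i}{n\mu^n_i}\Bigr),\qquad \hat X^n_i:=\frac1{\sqrt n}\Bigl(X^n_i-\frac{\lambda^n_i}{\mu^n_i}\Bigr)-\frac{\varrho^n}{m},\qquad \hat{\mathcal I}_1:=\Bigl\{i\in\mathcal I:\ \limsup_{n\to\infty}\frac{\gamma^n_i}{\mu^n_i}<1\Bigr\}.$$ Theorem. Suppose $\liminf_{n\to\infty}\varrho^n>0$. Then there is $n_0$ such that for every $n\ge n_0$ and every work-conserving stationary Markov policy $z$ the process $\hat X^n$ has a unique invariant probability distribution $\pi^n_z$, and for every $\eta>0$ the function $\hat x\mapsto\exp\bigl(\eta\sum_{i\in\hat{\mathcal I}_1}\hat x_i^-\bigr)$, where $y^-:=\max(-y,0)$, is integrable under $\pi^n_z$, uniformly in $n$ and $z$: $$\sup_{n\ge n_0}\ \sup_{z}\ \int \exp\Bigl(\eta\sum_{i\in\hat{\mathcal I}_1}\hat x_i^-\Bigr)\,\pi^n_z(d\hat x)<\infty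 .$$ -/

import Mathlib

open Filter Topology MeasureTheory
open scoped ENNReal

noncomputable section

/-! ### Continuous-time Markov chains on a discrete state space

A chain is given by its off-diagonal jump rates `q x y`, which describe the generator
`f ↦ (x ↦ ∑ y, q x y * (f y - f x))`. -/

namespace MarkovChain

variable {S : Type*}

/-- Total rate of leaving the state `x`. -/
def exitRate (q : S → S → ℝ≥0∞) (x : S) : ℝ≥0∞ := ∑' y, q x y

open Classical in
/-- The probability that the chain started at `x` is at `y` at time `t` after making fewer than
`k` jumps. The chain stays at `x` for an exponential time with parameter `exitRate q x`; if the
first jump is at time `s ≤ t`, it goes to `w` with intensity `q x w` and starts afresh there. -/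
def transitionUpTo (q : S → S → ℝ≥0∞) : ℕ → ℝ → S → S → ℝ≥0∞
  | 0, _, _, _ => 0
  | k + 1, t, x, y =>
      (if x = y then ENNReal.ofReal (Real.exp (-((exitRate q x).toReal * t))) else 0) +
        ∫⁻ s in Set.Ioc 0 t, ENNReal.ofReal (Real.exp (-((exitRate q x).toReal * s))) *
          ∑' w, q x w * transitionUpTo q k (t - s) w y

/-- The transition function `P_t(x, y)` of the (minimal) Markov jump process with jump
rates `q`. -/
def transition (q : S → S → ℝ≥0∞) (t : ℝ) (x y : S) : ℝ≥0∞ :=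
  ⨆ k, transitionUpTo q k t x y

/-- `π` is an invariant probability distribution of the chain: `π P_t = π` for all `t ≥ 0`. -/
structure IsInvariant [MeasurableSpace S] (q : S → S → ℝ≥0∞) (π : Measure S) : Prop where
  prob : IsProbabilityMeasure π
  inv : ∀ t : ℝ, 0 ≤ t → ∀ y, ∑' x, π {x} * transition q t x y = π {y}

end MarkovChain

/-! ### The multiclass many-server queue with Poisson arrivals

There are `m` classes; a state `x : Fin m → ℕ` counts the jobs of each class in the system. -/

namespace MulticlassQueue

variable {m : ℕ}

/-- A work-conserving stationary Markov scheduling policy for `n` servers: in state `x`, `z x i`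
jobs of class `i` are in service. -/
structure WorkConserving (n : ℕ) (z : (Fin m → ℕ) → Fin m → ℕ) : Prop where
  le_state : ∀ x i, z x i ≤ x i
  sum_eq : ∀ x, ∑ i, z x i = min n (∑ i, x i)

open Classical in
/-- Jump rates of the number-in-system process under the policy `z`, with arrival rates `lam`,
service rates `mu` and abandonment rates `gam`: `x → x + e_i` at rate `lam i`, and `x → x - e_i`
at rate `mu i * z_i + gam i * q_i`, where `q = x - z` is the vector of queue sizes. -/
def jumpRate (lam mu gam : Fin m → ℝ) (z : (Fin m → ℕ) → Fin m → ℕ) (x y : Fin m → ℕ) : ℝ≥0∞ :=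
  (∑ i, if y = x + Pi.single i 1 then ENNReal.ofReal (lam i) else 0) +
  (∑ i, if x = y + Pi.single i 1 then
    ENNReal.ofReal (mu i * (z x i : ℝ) + gam i * ((x i : ℝ) - (z x i : ℝ))) else 0)

/-- The spare capacity `ϱⁿ = √n (1 - ∑ i, λⁿ_i / (n μⁿ_i))` of the system with `n` servers. -/
def spareCapacity (lam mu : ℕ → Fin m → ℝ) (n : ℕ) : ℝ :=
  Real.sqrt n * (1 - ∑ i, lam n i / (n * mu n i))

/-- The diffusion scaling `x ↦ x̂ⁿ`. -/
def scaledState (lam mu : ℕ → Fin m → ℝ) (n : ℕ) (x : Fin m → ℕ) (i : Fin m) : ℝ :=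
  ((x i : ℝ) - lam n i / mu n i) / Real.sqrt n - spareCapacity lam mu n / m

/-- The Halfin--Whitt regime: `lam n`, `mu n`, `gam n` are the rates of the system with `n`
servers, and `lamLim`, `muLim`, `gamLim`, `lamHat`, `muHat` are the limits. -/
structure HalfinWhitt (lam mu gam : ℕ → Fin m → ℝ)
    (lamLim muLim gamLim lamHat muHat : Fin m → ℝ) : Prop where
  gam_nonneg : ∀ n i, 0 ≤ gam n i
  lamLim_pos : ∀ i, 0 < lamLim i
  muLim_pos : ∀ i, 0 < muLim i
  gamLim_nonneg : ∀ i, 0 ≤ gamLim i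
  tendsto_lam : ∀ i, Tendsto (fun n : ℕ => lam n i / n) atTop (𝓝 (lamLim i))
  tendsto_mu : ∀ i, Tendsto (fun n : ℕ => mu n i) atTop (𝓝 (muLim i))
  tendsto_gam : ∀ i, Tendsto (fun n : ℕ => gam n i) atTop (𝓝 (gamLim i))
  tendsto_lamHat : ∀ i,
    Tendsto (fun n : ℕ => (lam n i - n * lamLim i) / Real.sqrt n) atTop (𝓝 (lamHat i))
  tendsto_muHat : ∀ i,
    Tendsto (fun n : ℕ => Real.sqrt n * (mu n i - muLim i)) atTop (𝓝 (muHat i))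
  load_lt_one : ∀ i, lamLim i / muLim i < 1
  load_sum : ∑ i, lamLim i / muLim i = 1

open Classical in
/-- The set of classes `i` with `limsup γⁿ_i / μⁿ_i < 1`. -/
def slowAbandonment (mu gam : ℕ → Fin m → ℝ) : Finset (Fin m) :=
  Finset.univ.filter fun i => limsup (fun n : ℕ => gam n i / mu n i) atTop < 1

/-- The function `exp (η ∑ i ∈ I, y_i⁻)` of the scaled state, where `y_i⁻ = max (-y_i) 0`. -/
def expNegPart (η : ℝ) (I : Finset (Fin m)) (y : Fin m → ℝ) : ℝ :=
  Real.exp (η * ∑ i ∈ I, max (-(y i)) 0)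

end MulticlassQueue

end

/-! Both halves of the theorem are drift arguments for the jump chain of the unscaled state.

Moment bound. For a class with `γ ≤ μ` the departure rate `μ z + γ (x - z)` is at most `μ x`,
whatever the policy does. The class thus compares with an infinite-server queue, which below its
centre `λ/μ` is pushed up in proportion to its distance. For `V = exp (-θ x̂_i)` this gives `L V ≤ C
- V` (`exp_drift_le`): jumps of size `1/√n` at rates of order `n` leave a bounded second-order term
and a restoring term, so `C` depends neither on `n` nor on `z`. `IsInvariant.lintegral_le` turns the
drift into `∫ V ≤ C` for every invariant law, and `expNegPart_le` reduces the sum over classes to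
single classes with `θ = m η`.

Existence and uniqueness. The workload `∑ x_i/μ_i` has drift at most `∑ λ_i/μ_i - min(n, ∑ x_i)` by
work conservation, which is negative with all servers busy because the spare capacity is positive.
Finite restrictions of the chain have invariant vectors; a limit point is subinvariant for the
rates, and the drift keeps it nonzero. Decomposing at the last jump (`transitionExt_succ_forward`)
carries subinvariance over to the transition function, and non-explosion turns it into invariance.
Irreducibility makes all transition probabilities positive, which gives uniqueness. -/

noncomputable section

/-! ### Convolutions on the half-line -/

/-- A convolution integral over `(0, t]` as a convolution of functions extended by zero. -/
theorem setLIntegral_Ioc_eq_lconvolution (f g : ℝ → ℝ≥0∞) (t : ℝ) :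
    ∫⁻ s in Set.Ioc 0 t, f s * g (t - s) =
      lconvolution ((Set.Ici 0).indicator f) ((Set.Ici 0).indicator g) volume t := by
  rw [setLIntegral_congr Ioc_ae_eq_Icc, ← lintegral_indicator measurableSet_Icc,
    lconvolution_def]
  refine lintegral_congr fun s => ?_
  simp only [Set.indicator, Set.mem_Icc, Set.mem_Ici]
  by_cases h0 : 0 ≤ s <;> by_cases h1 : s ≤ t
  · have h2 : 0 ≤ -s + t := by linarith
    simp [h0, h1, neg_add_eq_sub]
  · have h2 : ¬ 0 ≤ -s + t := by linarith
    simp [h1, h2]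
  · simp [h0]
  · simp [h0]

theorem measurable_setLIntegral_Ioc {f g : ℝ → ℝ≥0∞} (hf : Measurable f) (hg : Measurable g) :
    Measurable fun t : ℝ => ∫⁻ s in Set.Ioc 0 t, f s * g (t - s) := by
  simp_rw [setLIntegral_Ioc_eq_lconvolution]
  exact measurable_lconvolution _ (hf.indicator measurableSet_Ici) (hg.indicator measurableSet_Ici)

/-- Later bounds dominate the integrand of the first-jump recursion by an explicit derivative, so
that the time integral telescopes. -/
theorem setLIntegral_Ioc_deriv {t : ℝ} (ht : 0 ≤ t) {F F' : ℝ → ℝ}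
    (hF : ∀ s, HasDerivAt F (F' s) s) (hc : Continuous F') (hpos : ∀ s ∈ Set.Ioc 0 t, 0 ≤ F' s) :
    ∫⁻ s in Set.Ioc 0 t, ENNReal.ofReal (F' s) = ENNReal.ofReal (F t - F 0) := by
  rw [← intervalIntegral.integral_eq_sub_of_hasDerivAt (fun s _ => hF s)
    (hc.intervalIntegrable _ _), intervalIntegral.integral_of_le ht,
    ofReal_integral_eq_lintegral_ofReal]
  · exact (hc.integrableOn_Icc (a := 0) (b := t)).mono_set Set.Ioc_subset_Icc_self
  · exact (ae_restrict_mem measurableSet_Ioc).mono fun s hs => hpos s hs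

theorem lconvolution_add_left {f g k : ℝ → ℝ≥0∞} (hf : Measurable f) (hk : Measurable k) :
    lconvolution (f + g) k volume = lconvolution f k volume + lconvolution g k volume := by
  ext t
  simp only [lconvolution_def, Pi.add_apply, add_mul]
  exact lintegral_add_left (by fun_prop) _

theorem lconvolution_add_right {f g k : ℝ → ℝ≥0∞} (hf : Measurable f) (hk : Measurable k) :
    lconvolution k (f + g) volume = lconvolution k f volume + lconvolution k g volume := by
  ext t
  simp only [lconvolution_def, Pi.add_apply, mul_add]
  exact lintegral_add_left (by fun_prop) _

theorem lconvolution_tsum_left {ι : Type*} [Countable ι] {c : ι → ℝ≥0∞} {f : ι → ℝ → ℝ≥0∞}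
    {k : ℝ → ℝ≥0∞} (hf : ∀ i, Measurable (f i)) (hk : Measurable k) :
    lconvolution (fun t => ∑' i, c i * f i t) k volume =
      fun t => ∑' i, c i * lconvolution (f i) k volume t := by
  ext t
  simp only [lconvolution_def]
  simp_rw [← ENNReal.tsum_mul_right]
  rw [lintegral_tsum fun i => by fun_prop]
  refine tsum_congr fun i => ?_
  rw [← lintegral_const_mul _ (by fun_prop)]
  simp_rw [mul_assoc]

theorem lconvolution_tsum_right {ι : Type*} [Countable ι] {c : ι → ℝ≥0∞} {f : ι → ℝ → ℝ≥0∞}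
    {k : ℝ → ℝ≥0∞} (hf : ∀ i, Measurable (f i)) (hk : Measurable k) :
    lconvolution k (fun t => ∑' i, c i * f i t) volume =
      fun t => ∑' i, c i * lconvolution k (f i) volume t := by
  ext t
  simp only [lconvolution_def]
  simp_rw [← ENNReal.tsum_mul_left]
  rw [lintegral_tsum fun i => by fun_prop]
  refine tsum_congr fun i => ?_
  rw [← lintegral_const_mul _ (by fun_prop)]
  simp_rw [mul_left_comm]

namespace MarkovChain

variable {S : Type*} {q : S → S → ℝ≥0∞}

/-! ### The transition function -/

theorem transitionUpTo_zero (t : ℝ) (x y : S) : transitionUpTo q 0 t x y = 0 := rfl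

open Classical in
theorem transitionUpTo_succ (k : ℕ) (t : ℝ) (x y : S) :
    transitionUpTo q (k + 1) t x y =
      (if x = y then ENNReal.ofReal (Real.exp (-((exitRate q x).toReal * t))) else 0) +
        ∫⁻ s in Set.Ioc 0 t, ENNReal.ofReal (Real.exp (-((exitRate q x).toReal * s))) *
          ∑' w, q x w * transitionUpTo q k (t - s) w y := rfl

theorem transitionUpTo_mono (t : ℝ) (x y : S) : Monotone fun k => transitionUpTo q k t x y := by
  refine monotone_nat_of_le_succ fun k => ?_
  induction k generalizing t x y with
  | zero => exact zero_le
  | succ k ih =>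
    rw [transitionUpTo_succ, transitionUpTo_succ]
    gcongr
    exact ih _ _ _

section Countable

variable [Countable S]

@[fun_prop]
theorem measurable_transitionUpTo (k : ℕ) (x y : S) :
    Measurable fun t => transitionUpTo q k t x y := by
  induction k generalizing x y with
  | zero => exact measurable_const
  | succ k ih =>
    simp_rw [transitionUpTo_succ]
    refine Measurable.add ?_ (measurable_setLIntegral_Ioc
      (g := fun u => ∑' w, q x w * transitionUpTo q k u w y) (by fun_prop)
      (Measurable.tsum fun w => (ih w y).const_mul _))
    split_ifs <;> fun_prop

/-- The recursion for the expectation of `f` before the `k`-th jump. -/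
theorem tsum_transitionUpTo_succ (f : S → ℝ≥0∞) (k : ℕ) (t : ℝ) (x : S) :
    ∑' y, transitionUpTo q (k + 1) t x y * f y =
      ENNReal.ofReal (Real.exp (-((exitRate q x).toReal * t))) * f x +
        ∫⁻ s in Set.Ioc 0 t, ENNReal.ofReal (Real.exp (-((exitRate q x).toReal * s))) *
          ∑' w, q x w * ∑' y, transitionUpTo q k (t - s) w y * f y := by
  classical
  simp_rw [transitionUpTo_succ, add_mul]
  rw [ENNReal.tsum_add]
  congr 1
  · rw [tsum_eq_single x]
    · simp
    · intro y hy
      simp [Ne.symm hy]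
  · have hm : ∀ y, Measurable fun s => ENNReal.ofReal (Real.exp (-((exitRate q x).toReal * s))) *
          ∑' w, q x w * transitionUpTo q k (t - s) w y := fun y =>
      Measurable.mul (by fun_prop) (Measurable.tsum fun w =>
        ((measurable_transitionUpTo k w y).comp (measurable_const.sub measurable_id)).const_mul _)
    simp_rw [← lintegral_mul_const _ (hm _)]
    rw [← lintegral_tsum fun y => ((hm y).mul_const _).aemeasurable]
    refine lintegral_congr fun s => ?_
    simp_rw [mul_assoc, ENNReal.tsum_mul_left]
    congr 1
    simp_rw [← ENNReal.tsum_mul_right, ← ENNReal.tsum_mul_left]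
    rw [ENNReal.tsum_comm]
    simp_rw [mul_assoc]

theorem tsum_transition_mul (f : S → ℝ≥0∞) (t : ℝ) (x : S) :
    ∑' y, transition q t x y * f y = ⨆ k, ∑' y, transitionUpTo q k t x y * f y := by
  -- Sums over `S` are integrals against counting measure, so monotone convergence applies.
  let _ : MeasurableSpace S := ⊤
  simp_rw [transition, ENNReal.iSup_mul, ← lintegral_count]
  refine lintegral_iSup (fun k => measurable_of_countable _) fun i j hij y => ?_
  exact mul_le_mul_left (transitionUpTo_mono t x y hij) _

end Countable

/-- Either the first jump comes after `t`, or its time has the exponential density on `(0, t]`. -/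
theorem exp_add_lintegral_exitRate (hq : ∀ x, exitRate q x ≠ ∞) {t : ℝ} (ht : 0 ≤ t) (x : S) :
    ENNReal.ofReal (Real.exp (-((exitRate q x).toReal * t))) +
      ∫⁻ s in Set.Ioc 0 t, ENNReal.ofReal (Real.exp (-((exitRate q x).toReal * s))) *
        exitRate q x = 1 := by
  set Q := (exitRate q x).toReal with hQ
  have hQ0 : 0 ≤ Q := ENNReal.toReal_nonneg
  rw [← ENNReal.ofReal_toReal (hq x), ← hQ]
  have h := setLIntegral_Ioc_deriv ht (F := fun s => -Real.exp (-(Q * s)))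
    (F' := fun s => Real.exp (-(Q * s)) * Q)
    (fun s => by
      have h1 : HasDerivAt (fun s => Real.exp (-(Q * s))) (Real.exp (-(Q * s)) * (-Q)) s := by
        simpa using (((hasDerivAt_id s).const_mul Q).neg).exp
      exact h1.neg.congr_deriv (by ring)) (by fun_prop) (fun s _ => by positivity)
  simp_rw [ENNReal.ofReal_mul (Real.exp_nonneg _)] at h
  rw [h, ← ENNReal.ofReal_add (by positivity)]
  · simp
  · have : Real.exp (-(Q * t)) ≤ 1 := Real.exp_le_one_iff.2 (by nlinarith)
    simpa using this

theorem tsum_transitionUpTo_le_one [Countable S]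
    (hq : ∀ x, exitRate q x ≠ ∞) (k : ℕ) {t : ℝ} (ht : 0 ≤ t)
    (x : S) : ∑' y, transitionUpTo q k t x y ≤ 1 := by
  induction k generalizing t x with
  | zero => simp [transitionUpTo_zero (q := q)]
  | succ k ih =>
    have h := tsum_transitionUpTo_succ (q := q) 1 k t x
    simp only [Pi.one_apply, mul_one] at h
    rw [h, ← exp_add_lintegral_exitRate hq ht x]
    refine add_le_add le_rfl (setLIntegral_mono' measurableSet_Ioc fun s hs => ?_)
    gcongr
    calc ∑' w, q x w * ∑' y, transitionUpTo q k (t - s) w y ≤ ∑' w, q x w * 1 := by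
          gcongr with w
          exact ih (by linarith [hs.2]) w
      _ = exitRate q x := by simp [exitRate]

theorem tsum_transition_le_one [Countable S]
    (hq : ∀ x, exitRate q x ≠ ∞) {t : ℝ} (ht : 0 ≤ t) (x : S) :
    ∑' y, transition q t x y ≤ 1 := by
  have h := tsum_transition_mul (q := q) 1 t x
  simp only [Pi.one_apply, mul_one] at h
  rw [h]
  exact iSup_le fun k => tsum_transitionUpTo_le_one hq k ht x

/-! ### Moment bounds from a drift condition -/

theorem tsum_rate_mul_affine (hq : ∀ x, exitRate q x ≠ ∞) {V : S → ℝ} (hV : ∀ x, 0 ≤ V x)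
    {a b : ℝ} (ha : 0 ≤ a) (hb : 0 ≤ b) (x : S) :
    ∑' w, q x w * ENNReal.ofReal (a * V w + b) =
      ENNReal.ofReal a * ∑' w, q x w * ENNReal.ofReal (V w) +
        ENNReal.ofReal ((exitRate q x).toReal * b) := by
  rw [ENNReal.ofReal_mul ENNReal.toReal_nonneg, ENNReal.ofReal_toReal (hq x), exitRate,
    ← ENNReal.tsum_mul_left, ← ENNReal.tsum_mul_right, ← ENNReal.tsum_add]
  refine tsum_congr fun w => ?_
  rw [ENNReal.ofReal_add (mul_nonneg ha (hV w)) hb, ENNReal.ofReal_mul ha]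
  ring

/-- Gronwall along the jump recursion. The drift condition is `L V ≤ C - V`, arranged so that
nothing is subtracted in `ℝ≥0∞`; the bound solves `u' = C - u`, `u(0) = V x`, and the first-jump
recursion preserves it. -/
theorem tsum_transitionUpTo_mul_le [Countable S]
    (hq : ∀ x, exitRate q x ≠ ∞) {V : S → ℝ} (hV : ∀ x, 0 ≤ V x)
    {C : ℝ} (hC : 0 ≤ C)
    (hdrift : ∀ x, ∑' w, q x w * ENNReal.ofReal (V w) + ENNReal.ofReal (V x) ≤
      ENNReal.ofReal ((exitRate q x).toReal * V x + C))
    (k : ℕ) {t : ℝ} (ht : 0 ≤ t) (x : S) :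
    ∑' y, transitionUpTo q k t x y * ENNReal.ofReal (V y) ≤
      ENNReal.ofReal (Real.exp (-t) * V x + C * (1 - Real.exp (-t))) := by
  induction k generalizing t x with
  | zero => simp [transitionUpTo_zero]
  | succ k ih =>
    rw [tsum_transitionUpTo_succ]
    have hd := hdrift x
    set Q := (exitRate q x).toReal with hQ
    have hQ0 : 0 ≤ Q := ENNReal.toReal_nonneg
    have hpos : ∀ r : ℝ, 0 ≤ r → 0 ≤ C * (1 - Real.exp (-r)) := fun r hr =>
      mul_nonneg hC (by simpa using hr)
    have hQV : 0 ≤ Q * V x + C := add_nonneg (mul_nonneg hQ0 (hV x)) hC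
    have hneg : 0 ≤ Q * V x - V x + C := by
      have := (ENNReal.ofReal_le_ofReal_iff hQV).1 (le_add_self.trans hd)
      linarith
    have hdx : ∑' w, q x w * ENNReal.ofReal (V w) ≤ ENNReal.ofReal (Q * V x - V x + C) := by
      rw [show Q * V x - V x + C = Q * V x + C - V x by ring, ENNReal.ofReal_sub _ (hV x)]
      exact ENNReal.le_sub_of_add_le_right ENNReal.ofReal_ne_top hd
    -- `-F s` is the probability of no jump before `s` times the bound for the remaining time; `F t
    -- - F 0` is the claimed bound minus the no-jump term.
    set F : ℝ → ℝ := fun s => -(Real.exp (-(Q * s)) *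
      (Real.exp (-(t - s)) * V x + C * (1 - Real.exp (-(t - s))))) with hF
    set F' : ℝ → ℝ := fun s => Real.exp (-(Q * s)) *
      (Real.exp (-(t - s)) * (Q * V x - V x + C) + Q * (C * (1 - Real.exp (-(t - s))))) with hF'
    have hderiv : ∀ s, HasDerivAt F (F' s) s := by
      intro s
      have h1 : HasDerivAt (fun s => Real.exp (-(Q * s))) (Real.exp (-(Q * s)) * (-Q)) s := by
        simpa using (((hasDerivAt_id s).const_mul Q).neg).exp
      have h2 : HasDerivAt (fun s => Real.exp (-(t - s))) (Real.exp (-(t - s))) s := by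
        simpa using (((hasDerivAt_id s).const_sub t).neg).exp
      have h3 := (h1.mul ((h2.mul_const (V x)).add ((h2.const_sub 1).const_mul C))).neg
      refine h3.congr_deriv ?_
      simp only [hF', Pi.add_apply]
      ring
    have hcont : Continuous F' := by
      simp only [hF']
      fun_prop
    have hF0 : ∀ s ≤ t, 0 ≤ F' s := fun s hs => mul_nonneg (Real.exp_nonneg _)
      (add_nonneg (mul_nonneg (Real.exp_nonneg _) hneg)
        (mul_nonneg hQ0 (hpos _ (by linarith))))
    have hb : ∀ s ∈ Set.Ioc 0 t,
        ENNReal.ofReal (Real.exp (-(Q * s))) *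
          ∑' w, q x w * ∑' y, transitionUpTo q k (t - s) w y * ENNReal.ofReal (V y) ≤
        ENNReal.ofReal (F' s) := by
      intro s hs
      have hr : 0 ≤ t - s := by linarith [hs.2]
      simp only [hF']
      rw [ENNReal.ofReal_mul (Real.exp_nonneg _)]
      gcongr
      calc _ ≤ ∑' w, q x w * ENNReal.ofReal (Real.exp (-(t - s)) * V w +
              C * (1 - Real.exp (-(t - s)))) := by
            gcongr with w
            exact ih hr w
        _ ≤ _ := by
            rw [tsum_rate_mul_affine hq hV (Real.exp_nonneg _) (hpos _ hr),
              ENNReal.ofReal_add (mul_nonneg (Real.exp_nonneg _) hneg)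
                (mul_nonneg hQ0 (hpos _ hr)), ENNReal.ofReal_mul (Real.exp_nonneg _)]
            gcongr
    calc _ ≤ ENNReal.ofReal (Real.exp (-(Q * t))) * ENNReal.ofReal (V x) +
          ∫⁻ s in Set.Ioc 0 t, ENNReal.ofReal (F' s) :=
          add_le_add le_rfl (setLIntegral_mono' measurableSet_Ioc hb)
      _ = ENNReal.ofReal (Real.exp (-(Q * t)) * V x) + ENNReal.ofReal (F t - F 0) := by
          rw [ENNReal.ofReal_mul (Real.exp_nonneg _), setLIntegral_Ioc_deriv ht hderiv hcont
            fun s hs => hF0 s hs.2]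
      _ = _ := by
          have h0 : F t - F 0 = (Real.exp (-t) * V x + C * (1 - Real.exp (-t))) -
              Real.exp (-(Q * t)) * V x := by
            simp [hF]
            ring
          have hmono : 0 ≤ F t - F 0 := by
            rw [← intervalIntegral.integral_eq_sub_of_hasDerivAt (fun s _ => hderiv s)
              (hcont.intervalIntegrable _ _)]
            exact intervalIntegral.integral_nonneg ht fun s hs => hF0 s hs.2
          rw [← ENNReal.ofReal_add (mul_nonneg (Real.exp_nonneg _) (hV x)) hmono, h0]
          congr 1
          ring

theorem tsum_transition_mul_le [Countable S] (hq : ∀ x, exitRate q x ≠ ∞) {V : S → ℝ}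
    (hV : ∀ x, 0 ≤ V x) {C : ℝ} (hC : 0 ≤ C)
    (hdrift : ∀ x, ∑' w, q x w * ENNReal.ofReal (V w) + ENNReal.ofReal (V x) ≤
      ENNReal.ofReal ((exitRate q x).toReal * V x + C)) {t : ℝ} (ht : 0 ≤ t) (x : S) :
    ∑' y, transition q t x y * ENNReal.ofReal (V y) ≤
      ENNReal.ofReal (Real.exp (-t) * V x + C) := by
  rw [tsum_transition_mul]
  refine iSup_le fun k => (tsum_transitionUpTo_mul_le hq hV hC hdrift k ht x).trans
    (ENNReal.ofReal_le_ofReal ?_)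
  have := mul_nonneg hC (Real.exp_nonneg (-t))
  linarith

/-- Integrals of truncated functions against an invariant distribution. -/
theorem IsInvariant.lintegral_min_le [Countable S] [MeasurableSpace S]
    [MeasurableSingletonClass S] (hq : ∀ x, exitRate q x ≠ ∞) {V : S → ℝ}
    (hV : ∀ x, 0 ≤ V x) {C : ℝ} (hC : 0 ≤ C)
    (hdrift : ∀ x, ∑' w, q x w * ENNReal.ofReal (V w) + ENNReal.ofReal (V x) ≤
      ENNReal.ofReal ((exitRate q x).toReal * V x + C)) {π : Measure S} (hπ : IsInvariant q π)
    (K : ℝ≥0∞) {t : ℝ} (ht : 0 ≤ t) :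
    ∫⁻ x, min (ENNReal.ofReal (V x)) K ∂π ≤
      ∫⁻ x, min (ENNReal.ofReal (Real.exp (-t) * V x + C)) K ∂π := by
  simp_rw [lintegral_countable']
  calc ∑' y, min (ENNReal.ofReal (V y)) K * π {y}
      = ∑' y, ∑' x, min (ENNReal.ofReal (V y)) K * (π {x} * transition q t x y) := by
        refine tsum_congr fun y => ?_
        rw [ENNReal.tsum_mul_left, hπ.inv t ht y]
    _ = ∑' x, (∑' y, transition q t x y * min (ENNReal.ofReal (V y)) K) * π {x} := by
        rw [ENNReal.tsum_comm]
        refine tsum_congr fun x => ?_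
        rw [← ENNReal.tsum_mul_right]
        exact tsum_congr fun y => by ring
    _ ≤ _ := by
        gcongr with x
        refine le_min ?_ ?_
        · refine le_trans ?_ (tsum_transition_mul_le hq hV hC hdrift ht x)
          gcongr
          exact min_le_left _ _
        · calc _ ≤ ∑' y, transition q t x y * K := by
                gcongr
                exact min_le_right _ _
            _ ≤ 1 * K := by
                rw [ENNReal.tsum_mul_right]
                gcongr
                exact tsum_transition_le_one hq ht x
            _ = K := one_mul K

/-- If the generator satisfies `L V ≤ C - V`, then `C` bounds the integral of `V` against every
invariant distribution. -/
theorem IsInvariant.lintegral_le [Countable S] [MeasurableSpace S]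
    [MeasurableSingletonClass S] (hq : ∀ x, exitRate q x ≠ ∞) {V : S → ℝ}
    (hV : ∀ x, 0 ≤ V x) {C : ℝ} (hC : 0 ≤ C)
    (hdrift : ∀ x, ∑' w, q x w * ENNReal.ofReal (V w) + ENNReal.ofReal (V x) ≤
      ENNReal.ofReal ((exitRate q x).toReal * V x + C)) {π : Measure S} (hπ : IsInvariant q π) :
    ∫⁻ x, ENNReal.ofReal (V x) ∂π ≤ ENNReal.ofReal C := by
  have := hπ.prob
  -- Integrability of `V` is not known in advance, hence the truncation: `t → ∞` with `K` fixed,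
  -- where dominated convergence removes `exp (-t) * V x`, and only then `K → ∞`.
  have hbound : ∀ K : ℕ, ∫⁻ x, min (ENNReal.ofReal (V x)) K ∂π ≤ ENNReal.ofReal C := by
    intro K
    have hlim : Tendsto (fun n : ℕ => ∫⁻ x, min (ENNReal.ofReal (Real.exp (-(n : ℝ)) * V x + C)) K
        ∂π) atTop (𝓝 (∫⁻ _, min (ENNReal.ofReal C) K ∂π)) := by
      refine tendsto_lintegral_of_dominated_convergence (fun _ => (K : ℝ≥0∞))
        (fun n => measurable_of_countable _) (fun n => ae_of_all _ fun x => min_le_right _ _)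
        (by simp) (ae_of_all _ fun x => ?_)
      refine Tendsto.min (ENNReal.tendsto_ofReal ?_) tendsto_const_nhds
      have h1 : Tendsto (fun n : ℕ => Real.exp (-(n : ℝ))) atTop (𝓝 0) :=
        Real.tendsto_exp_neg_atTop_nhds_zero.comp tendsto_natCast_atTop_atTop
      simpa using (h1.mul_const (V x)).add_const C
    refine (ge_of_tendsto' hlim fun n =>
      hπ.lintegral_min_le hq hV hC hdrift K (Nat.cast_nonneg n)).trans ?_
    simp
  have hsup : ∀ x, ENNReal.ofReal (V x) = ⨆ K : ℕ, min (ENNReal.ofReal (V x)) (K : ℝ≥0∞) := by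
    intro x
    rw [← inf_iSup_eq, ENNReal.iSup_natCast, inf_top_eq]
  rw [lintegral_congr hsup, lintegral_iSup (fun K => measurable_of_countable _)]
  · exact iSup_le hbound
  · intro i j hij x
    exact min_le_min le_rfl (by exact_mod_cast hij)

/-! ### Non-explosion -/

/-- Markov's inequality for the number of jumps up to `t`. The mean of `W` grows at most like `exp
(c s)` and the exit rate is at most `c W`, so the mean number of jumps is at most `W x (exp (c t) -
1)`. -/
theorem natCast_le_mul_tsum_transitionUpTo_add [Countable S] (hq : ∀ x, exitRate q x ≠ ∞) {W : S → ℝ}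
    (hW : ∀ x, 0 ≤ W x) {c : ℝ} (hc : 0 ≤ c) (hqW : ∀ x, (exitRate q x).toReal ≤ c * W x)
    (hdrift : ∀ x, ∑' w, q x w * ENNReal.ofReal (W w) ≤
      ENNReal.ofReal (((exitRate q x).toReal + c) * W x)) (k : ℕ) {t : ℝ} (ht : 0 ≤ t) (x : S) :
    (k : ℝ≥0∞) ≤ k * ∑' y, transitionUpTo q k t x y +
      ENNReal.ofReal (W x * (Real.exp (c * t) - 1)) := by
  induction k generalizing t x with
  | zero => simp
  | succ k ih =>
    have hrec := tsum_transitionUpTo_succ (q := q) 1 k t x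
    simp only [Pi.one_apply, mul_one] at hrec
    rw [hrec]
    have hsum := exp_add_lintegral_exitRate hq ht x
    have hd := hdrift x
    have hqx := hqW x
    set Q := (exitRate q x).toReal with hQ
    have hQ0 : 0 ≤ Q := ENNReal.toReal_nonneg
    have hexp : ∀ r : ℝ, 0 ≤ r → 0 ≤ Real.exp (c * r) - 1 := fun r hr => by
      simpa using mul_nonneg hc hr
    set F : ℝ → ℝ := fun s => -(Real.exp (-(Q * s)) * (W x * (Real.exp (c * (t - s)) - 1))) with hF
    set F' : ℝ → ℝ := fun s => Real.exp (-(Q * s)) *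
      ((Real.exp (c * (t - s)) - 1) * ((Q + c) * W x) + c * W x) with hF'
    have hderiv : ∀ s, HasDerivAt F (F' s) s := by
      intro s
      have h1 : HasDerivAt (fun s => Real.exp (-(Q * s))) (Real.exp (-(Q * s)) * (-Q)) s := by
        simpa using (((hasDerivAt_id s).const_mul Q).neg).exp
      have h2 : HasDerivAt (fun s => Real.exp (c * (t - s)))
          (Real.exp (c * (t - s)) * (-c)) s := by
        simpa using (((hasDerivAt_id s).const_sub t).const_mul c).exp
      refine (h1.mul ((h2.sub_const 1).const_mul (W x))).neg.congr_deriv ?_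
      simp only [hF']
      ring
    have hcont : Continuous F' := by
      simp only [hF']
      fun_prop
    have hint := setLIntegral_Ioc_deriv ht hderiv hcont fun s hs => mul_nonneg (Real.exp_nonneg _)
      (add_nonneg (mul_nonneg (hexp _ (by linarith [hs.2])) (mul_nonneg (by linarith) (hW x)))
        (mul_nonneg hc (hW x)))
    have hval : F t - F 0 = W x * (Real.exp (c * t) - 1) := by simp [hF]
    rw [hval] at hint
    set S' : ℝ → S → ℝ≥0∞ := fun r w => ∑' y, transitionUpTo q k r w y with hS'
    have hS'm : ∀ w, Measurable fun r => S' r w := fun w => Measurable.tsum fun y => by fun_prop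
    have hGm : Measurable fun s => ∑' w, q x w * S' (t - s) w :=
      Measurable.tsum fun w => ((hS'm w).comp (measurable_const.sub measurable_id)).const_mul _
    set E : ℝ → ℝ≥0∞ := fun s => ENNReal.ofReal (Real.exp (-(Q * s))) with hE
    have hEm : Measurable E := by fun_prop
    -- The first jump is paid for by `Q ≤ c W`, the next `k` by the induction hypothesis, whose term
    -- `k * S'` is enlarged to `(k + 1) * S'`.
    have hkey : ∀ s ∈ Set.Ioc 0 t, ((k : ℝ≥0∞) + 1) * (E s * exitRate q x) ≤
        ((k : ℝ≥0∞) + 1) * (E s * ∑' w, q x w * S' (t - s) w) + ENNReal.ofReal (F' s) := by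
      intro s hs
      have hr : 0 ≤ t - s := by linarith [hs.2]
      have h1 : ∑' w, q x w * ENNReal.ofReal (W w * (Real.exp (c * (t - s)) - 1)) +
          exitRate q x ≤ ENNReal.ofReal
            ((Real.exp (c * (t - s)) - 1) * ((Q + c) * W x) + c * W x) := by
        rw [ENNReal.ofReal_add (mul_nonneg (hexp _ hr) (mul_nonneg (by linarith) (hW x)))
          (mul_nonneg hc (hW x)), ENNReal.ofReal_mul (hexp _ hr)]
        refine add_le_add ?_ ?_
        · simp_rw [fun w => mul_comm (W w), ENNReal.ofReal_mul (hexp _ hr), mul_left_comm (q x _)]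
          rw [ENNReal.tsum_mul_left]
          gcongr
        · rw [← ENNReal.ofReal_toReal (hq x)]
          exact ENNReal.ofReal_le_ofReal hqx
      calc ((k : ℝ≥0∞) + 1) * (E s * exitRate q x)
          = E s * (∑' w, q x w * k + exitRate q x) := by
            rw [ENNReal.tsum_mul_right, exitRate]
            ring
        _ ≤ E s * (∑' w, q x w * (((k : ℝ≥0∞) + 1) * S' (t - s) w +
              ENNReal.ofReal (W w * (Real.exp (c * (t - s)) - 1))) + exitRate q x) := by
            gcongr with w
            refine (ih hr w).trans ?_
            gcongr
            exact le_self_add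
        _ = ((k : ℝ≥0∞) + 1) * (E s * ∑' w, q x w * S' (t - s) w) + E s *
              (∑' w, q x w * ENNReal.ofReal (W w * (Real.exp (c * (t - s)) - 1)) +
                exitRate q x) := by
            simp_rw [mul_add, ENNReal.tsum_add, mul_left_comm (q x _)]
            rw [ENNReal.tsum_mul_left]
            ring
        _ ≤ _ := by
            gcongr
            simp only [hF', hE]
            rw [ENNReal.ofReal_mul (Real.exp_nonneg _)]
            gcongr
    have hle := setLIntegral_mono' (μ := volume) measurableSet_Ioc hkey
    rw [lintegral_add_right _ (hcont.measurable.ennreal_ofReal), hint,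
      lintegral_const_mul _ (hEm.mul_const _),
      lintegral_const_mul _ (f := fun s => E s * ∑' w, q x w * S' (t - s) w) (hEm.mul hGm)] at hle
    calc ((k + 1 : ℕ) : ℝ≥0∞) = ((k : ℝ≥0∞) + 1) * 1 := by push_cast; ring
      _ = ((k : ℝ≥0∞) + 1) * E t + ((k : ℝ≥0∞) + 1) * ∫⁻ s in Set.Ioc 0 t, E s * exitRate q x := by
        rw [← mul_add, hsum]
      _ ≤ ((k : ℝ≥0∞) + 1) * E t + (((k : ℝ≥0∞) + 1) *
          (∫⁻ s in Set.Ioc 0 t, E s * ∑' w, q x w * S' (t - s) w) +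
            ENNReal.ofReal (W x * (Real.exp (c * t) - 1))) := by gcongr
      _ = _ := by
        push_cast
        ring

/-- A chain with at most linear growth does not explode. -/
theorem tsum_transition_eq_one [Countable S] (hq : ∀ x, exitRate q x ≠ ∞) {W : S → ℝ}
    (hW : ∀ x, 0 ≤ W x) {c : ℝ} (hc : 0 ≤ c) (hqW : ∀ x, (exitRate q x).toReal ≤ c * W x)
    (hdrift : ∀ x, ∑' w, q x w * ENNReal.ofReal (W w) ≤
      ENNReal.ofReal (((exitRate q x).toReal + c) * W x)) {t : ℝ} (ht : 0 ≤ t) (x : S) :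
    ∑' y, transition q t x y = 1 := by
  refine le_antisymm (tsum_transition_le_one hq ht x) ?_
  set H := ENNReal.ofReal (W x * (Real.exp (c * t) - 1)) with hH
  set P := ∑' y, transition q t x y with hP
  have h : ∀ k : ℕ, (k : ℝ≥0∞) ≤ k * P + H := fun k =>
    (natCast_le_mul_tsum_transitionUpTo_add hq hW hc hqW hdrift k ht x).trans <| by
      gcongr
      exact ENNReal.tsum_le_tsum fun y => le_iSup (fun k => transitionUpTo q k t x y) k
  have hlim : Tendsto (fun k : ℕ => P + H / ((k + 1 : ℕ) : ℝ≥0∞)) atTop (𝓝 (P + 0)) := by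
    refine tendsto_const_nhds.add ?_
    have := ENNReal.Tendsto.const_div (a := H)
      (ENNReal.tendsto_nat_nhds_top.comp (tendsto_add_atTop_nat 1)) (Or.inr ENNReal.ofReal_ne_top)
    rwa [ENNReal.div_top] at this
  rw [add_zero] at hlim
  refine ge_of_tendsto' hlim fun k => ?_
  have h0 : ((k + 1 : ℕ) : ℝ≥0∞) ≠ 0 := by exact_mod_cast Nat.succ_ne_zero k
  have ht' : ((k + 1 : ℕ) : ℝ≥0∞) ≠ ∞ := ENNReal.natCast_ne_top _
  calc (1 : ℝ≥0∞) = ((k + 1 : ℕ) : ℝ≥0∞) / ((k + 1 : ℕ) : ℝ≥0∞) := (ENNReal.div_self h0 ht').symm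
    _ ≤ (((k + 1 : ℕ) : ℝ≥0∞) * P + H) / ((k + 1 : ℕ) : ℝ≥0∞) := by
      gcongr
      exact h (k + 1)
    _ = _ := by
      rw [ENNReal.add_div, mul_comm, ENNReal.mul_div_cancel_right h0 ht']

/-! ### The forward recursion -/

/-- The survival function of an exponential time with parameter `a`, extended by zero. -/
def survival (a : ℝ) : ℝ → ℝ≥0∞ :=
  (Set.Ici 0).indicator fun t => ENNReal.ofReal (Real.exp (-(a * t)))

/-- `transitionUpTo`, extended by zero to negative times. -/
def transitionExt (q : S → S → ℝ≥0∞) (k : ℕ) (x y : S) : ℝ → ℝ≥0∞ :=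
  (Set.Ici 0).indicator fun t => transitionUpTo q k t x y

@[fun_prop]
theorem measurable_survival (a : ℝ) : Measurable (survival a) :=
  Measurable.indicator (by fun_prop) measurableSet_Ici

@[fun_prop]
theorem measurable_transitionExt [Countable S] (k : ℕ) (x y : S) :
    Measurable (transitionExt q k x y) :=
  Measurable.indicator (by fun_prop) measurableSet_Ici

-- Extension by zero makes the recursion a convolution on the whole line, where associativity and
-- commutativity are available.
open Classical in
theorem transitionExt_succ [Countable S] (k : ℕ) (x y : S) :
    transitionExt q (k + 1) x y =
      (if x = y then survival (exitRate q x).toReal else 0) + fun t => ∑' w, q x w *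
        lconvolution (survival (exitRate q x).toReal) (transitionExt q k w y) volume t := by
  ext t
  rw [Pi.add_apply]
  simp_rw [survival, transitionExt, ← setLIntegral_Ioc_eq_lconvolution]
  by_cases ht : 0 ≤ t
  · rw [Set.indicator_of_mem (Set.mem_Ici.2 ht), transitionUpTo_succ]
    congr 1
    · split_ifs <;> simp [ht]
    · have hm : ∀ w, Measurable fun s => ENNReal.ofReal (Real.exp (-((exitRate q x).toReal * s))) *
          transitionUpTo q k (t - s) w y := fun w => Measurable.mul (by fun_prop)
        ((measurable_transitionUpTo k w y).comp (measurable_const.sub measurable_id))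
      simp_rw [← lintegral_const_mul _ (hm _)]
      rw [← lintegral_tsum fun w => ((hm w).const_mul _).aemeasurable]
      refine lintegral_congr fun s => ?_
      rw [← ENNReal.tsum_mul_left]
      exact tsum_congr fun w => by ring
  · have h0 : Set.Ioc 0 t = ∅ := Set.Ioc_eq_empty (by linarith)
    rw [Set.indicator_of_notMem (by simpa using ht), h0]
    split_ifs <;> simp [ht]

-- Decomposition at the last jump instead of the first, as needed for subinvariance, which controls
-- the flux into a state. In the induction both end jumps are split off; associativity of
-- convolution makes their order irrelevant.
open Classical in
theorem transitionExt_succ_forward [Countable S] (k : ℕ) (x y : S) :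
    transitionExt q (k + 1) x y =
      (if x = y then survival (exitRate q x).toReal else 0) + fun t => ∑' w, q w y *
        lconvolution (transitionExt q k x w) (survival (exitRate q y).toReal) volume t := by
  induction k generalizing x with
  | zero =>
    have h0 : ∀ x y, transitionExt q 0 x y = 0 := fun x y => by
      ext t
      simp [transitionExt, transitionUpTo_zero]
    rw [transitionExt_succ]
    simp [h0]
  | succ k ih =>
    have hif : ∀ w z : S, Measurable (if w = z then survival (exitRate q w).toReal else 0) := by
      intro w z
      split_ifs
      · fun_prop
      · exact measurable_zero
    have hl : ∀ w, lconvolution (survival (exitRate q x).toReal) (transitionExt q (k + 1) w y)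
        volume = lconvolution (survival (exitRate q x).toReal)
          (if w = y then survival (exitRate q w).toReal else 0) volume +
          fun t => ∑' v, q v y * lconvolution (lconvolution (survival (exitRate q x).toReal)
            (transitionExt q k w v) volume) (survival (exitRate q y).toReal) volume t := by
      intro w
      rw [ih w, lconvolution_add_right (hif _ _) (by fun_prop),
        lconvolution_tsum_right (fun v => by fun_prop) (by fun_prop)]
      congr 1
      ext t
      refine tsum_congr fun v => ?_
      rw [lconvolution_assoc (by fun_prop) (by fun_prop) (by fun_prop)]
    have hr : ∀ w, lconvolution (transitionExt q (k + 1) x w) (survival (exitRate q y).toReal)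
        volume = lconvolution (if x = w then survival (exitRate q x).toReal else 0)
          (survival (exitRate q y).toReal) volume +
          fun t => ∑' v, q x v * lconvolution (lconvolution (survival (exitRate q x).toReal)
            (transitionExt q k v w) volume) (survival (exitRate q y).toReal) volume t := by
      intro w
      rw [transitionExt_succ k x w, lconvolution_add_left (hif _ _) (by fun_prop),
        lconvolution_tsum_left (fun v => by fun_prop) (by fun_prop)]
    rw [transitionExt_succ (k + 1)]
    congr 1
    ext t
    simp_rw [hl, hr, Pi.add_apply, mul_add]
    rw [ENNReal.tsum_add, ENNReal.tsum_add]
    congr 1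
    · rw [tsum_eq_single y (fun w hw => by simp [hw]),
        tsum_eq_single x (fun w hw => by simp [hw.symm])]
      simp
    · simp_rw [← ENNReal.tsum_mul_left]
      rw [ENNReal.tsum_comm]
      exact tsum_congr fun v => tsum_congr fun w => by ring

/-- A measure which is subinvariant for the jump rates is subinvariant for the chain. -/
theorem tsum_mul_transitionUpTo_le [Countable S] (hq : ∀ x, exitRate q x ≠ ∞) {p : S → ℝ≥0∞}
    (hp : ∀ y, ∑' x, p x * q x y ≤ p y * exitRate q y) (k : ℕ) {t : ℝ} (ht : 0 ≤ t) (y : S) :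
    ∑' x, p x * transitionUpTo q k t x y ≤ p y := by
  classical
  induction k generalizing t y with
  | zero => simp [transitionUpTo_zero]
  | succ k ih =>
    have hext : ∀ j x, transitionUpTo q j t x y = transitionExt q j x y t := fun j x => by
      simp [transitionExt, ht]
    -- The flux into `y` at time `s` when starting from `p`: the induction hypothesis bounds the
    -- mass at each `w` by `p w`, and `hp` bounds the resulting inflow.
    have hflux : ∀ s, ∑' w, q w y * ∑' x, p x * transitionExt q k x w s ≤
        (Set.Ici 0).indicator (fun _ => p y * exitRate q y) s := by
      intro s
      by_cases hs : 0 ≤ s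
      · rw [Set.indicator_of_mem (Set.mem_Ici.2 hs)]
        refine le_trans (ENNReal.tsum_le_tsum fun w => ?_) (hp y)
        rw [mul_comm (p w)]
        gcongr
        simpa [transitionExt, hs] using ih hs w
      · simp [transitionExt, hs]
    calc ∑' x, p x * transitionUpTo q (k + 1) t x y
        = p y * survival (exitRate q y).toReal t +
          lconvolution (fun s => ∑' w, q w y * ∑' x, p x * transitionExt q k x w s)
            (survival (exitRate q y).toReal) volume t := by
          rw [lconvolution_tsum_left (fun w => Measurable.tsum fun x => by fun_prop)
            (by fun_prop)]
          simp_rw [hext, transitionExt_succ_forward, Pi.add_apply, mul_add]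
          rw [ENNReal.tsum_add]
          congr 1
          · rw [tsum_eq_single y (fun x hx => by simp [hx])]
            simp
          · simp_rw [← ENNReal.tsum_mul_left]
            rw [ENNReal.tsum_comm]
            refine tsum_congr fun w => ?_
            rw [lconvolution_tsum_left (fun x => by fun_prop) (by fun_prop),
              ← ENNReal.tsum_mul_left]
            exact tsum_congr fun x => by ring
      _ ≤ p y * survival (exitRate q y).toReal t +
          lconvolution ((Set.Ici 0).indicator (fun _ => p y * exitRate q y))
            (survival (exitRate q y).toReal) volume t := by
          gcongr
          exact lintegral_mono fun s => mul_le_mul_left (hflux s) _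
      _ = p y * (ENNReal.ofReal (Real.exp (-((exitRate q y).toReal * t))) +
          ∫⁻ s in Set.Ioc 0 t, ENNReal.ofReal (Real.exp (-((exitRate q y).toReal * s))) *
            exitRate q y) := by
          rw [lconvolution_comm, survival, ← setLIntegral_Ioc_eq_lconvolution, mul_add,
            Set.indicator_of_mem (Set.mem_Ici.2 ht), ← lintegral_const_mul _ (by fun_prop)]
          congr 1
          exact lintegral_congr fun s => by ring
      _ = p y := by rw [exp_add_lintegral_exitRate hq ht, mul_one]

theorem tsum_mul_transition_le [Countable S] (hq : ∀ x, exitRate q x ≠ ∞) {p : S → ℝ≥0∞}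
    (hp : ∀ y, ∑' x, p x * q x y ≤ p y * exitRate q y) {t : ℝ} (ht : 0 ≤ t) (y : S) :
    ∑' x, p x * transition q t x y ≤ p y := by
  let _ : MeasurableSpace S := ⊤
  simp_rw [transition, ENNReal.mul_iSup, ← lintegral_count]
  rw [lintegral_iSup (f := fun k x => p x * transitionUpTo q k t x y)
    (fun k => measurable_of_countable _) fun i j hij x =>
      mul_le_mul_right (transitionUpTo_mono t x y hij) _]
  refine iSup_le fun k => ?_
  rw [lintegral_count]
  exact tsum_mul_transitionUpTo_le hq hp k ht y

/-- A strict inequality at one point would separate the finite sums. This is how conservation of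
mass upgrades subinvariance to invariance. -/
theorem eq_of_le_of_tsum_le {f g : S → ℝ≥0∞} (hf : ∑' x, f x ≠ ∞) (hfg : ∀ x, f x ≤ g x)
    (h : ∑' x, g x ≤ ∑' x, f x) (x : S) : f x = g x := by
  by_contra hne
  exact (ENNReal.tsum_lt_tsum hf hfg (lt_of_le_of_ne (hfg x) hne)).not_ge h

/-- A subinvariant probability vector of a chain which does not explode is an invariant
distribution. -/
theorem exists_isInvariant_of_subinvariant [Countable S] [MeasurableSpace S]
    [MeasurableSingletonClass S] (hq : ∀ x, exitRate q x ≠ ∞)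
    (hone : ∀ t : ℝ, 0 ≤ t → ∀ x, ∑' y, transition q t x y = 1) {p : S → ℝ≥0∞}
    (hp1 : ∑' x, p x = 1) (hp : ∀ y, ∑' x, p x * q x y ≤ p y * exitRate q y) :
    ∃ π : Measure S, IsInvariant q π := by
  have hsum : HasSum p 1 := hp1 ▸ ENNReal.summable.hasSum
  let P : PMF S := ⟨p, hsum⟩
  refine ⟨P.toMeasure, inferInstance, fun t ht y => ?_⟩
  simp_rw [PMF.toMeasure_apply_singleton _ _ (measurableSet_singleton _)]
  change ∑' x, p x * transition q t x y = p y
  have hmass : ∑' y, ∑' x, p x * transition q t x y = 1 := by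
    rw [ENNReal.tsum_comm]
    simp_rw [ENNReal.tsum_mul_left, hone t ht, mul_one, hp1]
  exact eq_of_le_of_tsum_le (f := fun y => ∑' x, p x * transition q t x y)
    (by rw [hmass]; exact ENNReal.one_ne_top) (tsum_mul_transition_le hq hp ht)
    (by rw [hmass, hp1]) y

/-! ### Irreducible chains -/

/-- Induction from the start of a path of positive rates. `k` is one more than the number of steps
and does not depend on `t`, so it serves for every remaining time `t - s`. -/
theorem exists_transitionUpTo_pos [Countable S] {x y : S}
    (h : Relation.ReflTransGen (fun x y => q x y ≠ 0) x y) :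
    ∃ k, ∀ t : ℝ, 0 < t → 0 < transitionUpTo q k t x y := by
  classical
  induction h using Relation.ReflTransGen.head_induction_on with
  | refl =>
    refine ⟨1, fun t _ => ?_⟩
    rw [transitionUpTo_succ, if_pos rfl]
    exact (ENNReal.ofReal_pos.2 (Real.exp_pos _)).trans_le le_self_add
  | @head x w hxw _ ih =>
    obtain ⟨k, hk⟩ := ih
    refine ⟨k + 1, fun t ht => ?_⟩
    rw [transitionUpTo_succ]
    refine lt_of_lt_of_le ?_ le_add_self
    have hm : Measurable fun s => ENNReal.ofReal (Real.exp (-((exitRate q x).toReal * s))) *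
        ∑' w, q x w * transitionUpTo q k (t - s) w y :=
      Measurable.mul (by fun_prop) (Measurable.tsum fun w =>
        ((measurable_transitionUpTo k w y).comp (measurable_const.sub measurable_id)).const_mul _)
    rw [setLIntegral_pos_iff hm]
    -- The endpoint `s = t` is left out: no time would remain for the rest of the path.
    refine lt_of_lt_of_le ?_ (measure_mono (s := Set.Ioo 0 t) fun s hs => ⟨?_, hs.1, hs.2.le⟩)
    · simpa using ht
    · rw [Function.mem_support]
      refine mul_ne_zero (ENNReal.ofReal_pos.2 (Real.exp_pos _)).ne' fun h0 => ?_
      exact mul_ne_zero hxw (hk (t - s) (by linarith [hs.2])).ne' (ENNReal.tsum_eq_zero.1 h0 w)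

theorem transition_pos [Countable S] {x y : S}
    (h : Relation.ReflTransGen (fun x y => q x y ≠ 0) x y) {t : ℝ} (ht : 0 < t) :
    0 < transition q t x y := by
  obtain ⟨k, hk⟩ := exists_transitionUpTo_pos h
  exact (hk t ht).trans_le (le_iSup (fun k => transitionUpTo q k t x y) k)

/-- An irreducible substochastic kernel has at most one invariant probability vector. -/
theorem eq_of_irreducible {P : S → S → ℝ≥0∞} (hP : ∀ x y, 0 < P x y)
    (hP1 : ∀ x, ∑' y, P x y ≤ 1) {p p' : S → ℝ≥0∞} (hp1 : ∑' x, p x = 1) (hp1' : ∑' x, p' x = 1)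
    (hp : ∀ y, ∑' x, p x * P x y = p y) (hp' : ∀ y, ∑' x, p' x * P x y = p' y) : p = p' := by
  have hpos : ∀ f : S → ℝ≥0∞, (∀ y, ∑' x, f x * P x y = f y) → (∃ x, f x ≠ 0) →
      ∀ y, f y ≠ 0 := by
    rintro f hf ⟨x, hx⟩ y h0
    have h := hf y
    rw [h0, ENNReal.tsum_eq_zero] at h
    exact mul_ne_zero hx (hP x y).ne' (h x)
  have hex : ∀ f : S → ℝ≥0∞, ∑' x, f x ≠ 0 → ∃ x, f x ≠ 0 := fun f hf => by
    by_contra! h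
    exact hf (ENNReal.tsum_eq_zero.2 h)
  have hle : ∀ x, p x ≤ 1 := fun x => (ENNReal.le_tsum x).trans hp1.le
  -- The mass of `p` is preserved and `p` is positive everywhere, so no row can lose mass.
  have hrow : ∀ x, ∑' y, P x y = 1 := by
    intro x
    have h := eq_of_le_of_tsum_le (f := fun x => p x * ∑' y, P x y) (g := p) (by
      simp_rw [← ENNReal.tsum_mul_left]
      rw [ENNReal.tsum_comm]
      simp_rw [hp, hp1]
      exact ENNReal.one_ne_top) (fun x => mul_le_of_le_one_right' (hP1 x)) (by
      simp_rw [← ENNReal.tsum_mul_left]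
      rw [ENNReal.tsum_comm]
      simp_rw [hp]
      exact le_rfl) x
    have hx := hpos p hp (hex p (by simp [hp1])) x
    exact (ENNReal.mul_eq_left hx (ne_top_of_le_ne_top ENNReal.one_ne_top (hle x))).1 h
  -- `m P ≤ m` with equal mass, so `m` is invariant, and so are `p - m` and `p' - m`. If `p ≠ p'`
  -- both are nonzero, hence positive everywhere, although at each point one of them vanishes.
  set m : S → ℝ≥0∞ := fun x => min (p x) (p' x) with hm
  have hmfin : ∀ x, m x ≠ ∞ := fun x =>
    ne_top_of_le_ne_top ENNReal.one_ne_top ((min_le_left _ _).trans (hle x))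
  have hmsum : ∑' x, m x ≤ 1 := hp1 ▸ ENNReal.tsum_le_tsum fun x => min_le_left _ _
  have hmass : ∑' y, ∑' x, m x * P x y = ∑' x, m x := by
    rw [ENNReal.tsum_comm]
    simp_rw [ENNReal.tsum_mul_left, hrow, mul_one]
  have hminv : ∀ y, ∑' x, m x * P x y = m y :=
    eq_of_le_of_tsum_le (by
      rw [hmass]
      exact ne_top_of_le_ne_top ENNReal.one_ne_top hmsum) (fun y => le_min
        ((ENNReal.tsum_le_tsum fun x => mul_le_mul_left (min_le_left _ _) _).trans (hp y).le)
        ((ENNReal.tsum_le_tsum fun x => mul_le_mul_left (min_le_right _ _) _).trans (hp' y).le))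
      hmass.ge
  have hsub : ∀ f : S → ℝ≥0∞, (∀ x, m x ≤ f x) → (∀ y, ∑' x, f x * P x y = f y) →
      ∀ y, ∑' x, (f x - m x) * P x y = f y - m y := by
    intro f hmf hf y
    refine (ENNReal.eq_sub_of_add_eq (hmfin y) ?_)
    conv_lhs => rw [← hminv y]
    rw [← ENNReal.tsum_add, ← hf y]
    refine tsum_congr fun x => ?_
    rw [← add_mul, tsub_add_cancel_of_le (hmf x)]
  have hne : ∀ f : S → ℝ≥0∞, ∑' x, f x = 1 → (∀ x, m x ≤ f x) → p ≠ p' →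
      ∃ x, f x - m x ≠ 0 := by
    intro f hf1 hmf hne
    by_contra! h
    have hfm : ∀ x, f x = m x := fun x => le_antisymm (tsub_eq_zero_iff_le.1 (h x)) (hmf x)
    have hm1 : ∑' x, m x = 1 := by rw [← hf1, tsum_congr hfm]
    refine hne (funext fun x => ?_)
    rw [← eq_of_le_of_tsum_le (f := m) (g := p) (by simp [hm1]) (fun x => min_le_left _ _)
      (by rw [hm1, hp1]) x]
    exact eq_of_le_of_tsum_le (f := m) (g := p') (by simp [hm1]) (fun x => min_le_right _ _)
      (by rw [hm1, hp1']) x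
  by_contra hpp
  obtain ⟨x, hx⟩ := hne p hp1 (fun x => min_le_left _ _) hpp
  have h1 := hpos _ (hsub p (fun x => min_le_left _ _) hp) ⟨x, hx⟩ x
  have h2 := hpos _ (hsub p' (fun x => min_le_right _ _) hp')
    (hne p' hp1' (fun x => min_le_right _ _) hpp) x
  rcases min_choice (p x) (p' x) with h | h
  · exact h1 (by simp [hm, h])
  · exact h2 (by simp [hm, h])

theorem IsInvariant.tsum_singleton [Countable S] [MeasurableSpace S] [MeasurableSingletonClass S]
    {π : Measure S} (hπ : IsInvariant q π) : ∑' x, π {x} = 1 := by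
  have := hπ.prob
  have h := lintegral_countable' (μ := π) (fun _ : S => (1 : ℝ≥0∞))
  simpa using h.symm

/-- An irreducible chain has at most one invariant distribution. -/
theorem IsInvariant.eq_of_irreducible [Countable S] [MeasurableSpace S]
    [MeasurableSingletonClass S] (hq : ∀ x, exitRate q x ≠ ∞)
    (hirr : ∀ x y, Relation.ReflTransGen (fun x y => q x y ≠ 0) x y) {π π' : Measure S}
    (hπ : IsInvariant q π) (hπ' : IsInvariant q π') : π = π' := by
  refine Measure.ext_of_singleton fun x => ?_
  exact congrFun (MarkovChain.eq_of_irreducible (P := transition q 1)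
    (p := fun x => π {x}) (p' := fun x => π' {x})
    (fun x y => transition_pos (hirr x y) one_pos) (tsum_transition_le_one hq zero_le_one)
    hπ.tsum_singleton hπ'.tsum_singleton (hπ.inv 1 zero_le_one) (hπ'.inv 1 zero_le_one)) x

/-! ### Foster's criterion -/

/-- A finite chain has an invariant probability vector. -/
theorem exists_invariant_vector {ι : Type*} [Fintype ι] [Nonempty ι] {r : ι → ι → ℝ}
    (hr : ∀ x y, 0 ≤ r x y) :
    ∃ p : ι → ℝ, (∀ x, 0 ≤ p x) ∧ ∑ x, p x = 1 ∧ ∀ y, ∑ x, p x * r x y = p y * ∑ w, r y w := by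
  classical
  -- The generator matrix annihilates constants, so it has a left null vector `v`, possibly with
  -- changing signs.
  let M : Matrix ι ι ℝ := Matrix.of r - Matrix.diagonal fun x => ∑ w, r x w
  have hdet : M.det = 0 := by
    refine Matrix.exists_mulVec_eq_zero_iff.1 ⟨1, one_ne_zero, ?_⟩
    ext x
    simp [M, Matrix.mulVec, dotProduct, Matrix.diagonal_apply]
  obtain ⟨v, hv0, hv⟩ := Matrix.exists_vecMul_eq_zero_iff.2 hdet
  have hbal : ∀ y, ∑ x, v x * r x y = v y * ∑ w, r y w := by
    intro y
    have h := congrFun hv y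
    simpa [M, Matrix.vecMul, dotProduct, Matrix.diagonal_apply, mul_sub, sub_eq_zero] using h
  have hle : ∀ y, |v y| * ∑ w, r y w ≤ ∑ x, |v x| * r x y := by
    intro y
    calc |v y| * ∑ w, r y w = |∑ x, v x * r x y| := by
          rw [hbal, abs_mul, abs_of_nonneg (Finset.sum_nonneg fun w _ => hr y w)]
      _ ≤ ∑ x, |v x * r x y| := Finset.abs_sum_le_sum_abs _ _
      _ = _ := Finset.sum_congr rfl fun x _ => by rw [abs_mul, abs_of_nonneg (hr x y)]
  -- Summed over `y`, both sides of `hle` agree; hence each inequality is an equality and `|v|` is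
  -- invariant too.
  have heq : ∀ y, |v y| * ∑ w, r y w = ∑ x, |v x| * r x y := by
    have h := (Finset.sum_eq_sum_iff_of_le (s := Finset.univ) fun y _ => hle y).1 (by
      simp_rw [Finset.mul_sum]
      exact Finset.sum_comm)
    exact fun y => h y (Finset.mem_univ y)
  have hT : 0 < ∑ x, |v x| := by
    obtain ⟨x, hx⟩ := Function.ne_iff.1 hv0
    exact Finset.sum_pos' (fun x _ => abs_nonneg _) ⟨x, Finset.mem_univ x, abs_pos.2 hx⟩
  refine ⟨fun x => |v x| / ∑ x, |v x|, fun x => div_nonneg (abs_nonneg _) hT.le, ?_, fun y => ?_⟩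
  · rw [← Finset.sum_div, div_self hT.ne']
  · rw [div_mul_eq_mul_div, heq, Finset.sum_div]
    exact Finset.sum_congr rfl fun x _ => by rw [div_mul_eq_mul_div]

/-- The drift condition is inherited by the chain restricted to a sublevel set. -/
theorem sum_sublevel_drift (hq : ∀ x, exitRate q x ≠ ∞) {V : S → ℝ} (hV : ∀ x, 0 ≤ V x)
    {ε : ℝ} (hε : 0 ≤ ε) {g : S → ℝ} (hg : ∀ x, 0 ≤ g x)
    (hdrift : ∀ x, ∑' w, q x w * ENNReal.ofReal (V w) + ENNReal.ofReal ε ≤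
      ENNReal.ofReal ((exitRate q x).toReal * V x + g x)) {N : ℝ} {A : Finset S}
    (hA : ∀ x, x ∈ A ↔ V x ≤ N) {x : S} (hx : x ∈ A) :
    ∑ w ∈ A, (q x w).toReal * (V w - V x) ≤ g x - ε := by
  classical
  have hd := hdrift x
  have hfin : ∑' w, q x w * ENNReal.ofReal (V w) ≠ ∞ :=
    ne_top_of_le_ne_top ENNReal.ofReal_ne_top (le_self_add.trans hd)
  have hqfin : ∀ w, q x w ≠ ∞ := fun w =>
    ne_top_of_le_ne_top (hq x) (ENNReal.le_tsum w)
  have hrs : Summable fun w => (q x w).toReal := ENNReal.summable_toReal (hq x)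
  have hrV : Summable fun w => (q x w).toReal * V w := by
    simpa [ENNReal.toReal_mul, ENNReal.toReal_ofReal (hV _)] using ENNReal.summable_toReal hfin
  have hQ : (exitRate q x).toReal = ∑' w, (q x w).toReal := ENNReal.tsum_toReal_eq hqfin
  have hreal : ∑' w, (q x w).toReal * V w + ε ≤ (exitRate q x).toReal * V x + g x := by
    have h := ENNReal.toReal_mono ENNReal.ofReal_ne_top hd
    rw [ENNReal.toReal_add hfin ENNReal.ofReal_ne_top, ENNReal.toReal_ofReal hε,
      ENNReal.toReal_ofReal (add_nonneg (mul_nonneg ENNReal.toReal_nonneg (hV x)) (hg x)),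
      ENNReal.tsum_toReal_eq fun w => ENNReal.mul_ne_top (hqfin w) ENNReal.ofReal_ne_top] at h
    simpa [ENNReal.toReal_mul, ENNReal.toReal_ofReal (hV _)] using h
  have hdiff : ∑' w, (q x w).toReal * (V w - V x) =
      ∑' w, (q x w).toReal * V w - (exitRate q x).toReal * V x := by
    simp_rw [mul_sub]
    rw [hrV.tsum_sub (hrs.mul_right _), tsum_mul_right, hQ]
  have hsum : Summable fun w => (q x w).toReal * (V w - V x) := by
    simp_rw [mul_sub]
    exact hrV.sub (hrs.mul_right _)
  -- The discarded jumps leave the sublevel set and therefore raise `V`.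
  have hle : ∑ w ∈ A, (q x w).toReal * (V w - V x) ≤ ∑' w, (q x w).toReal * (V w - V x) := by
    refine hsum.sum_le_tsum A fun w hw => mul_nonneg ENNReal.toReal_nonneg ?_
    have h1 := (hA x).1 hx
    have h2 := mt (hA w).2 hw
    linarith
  linarith

/-- An invariant probability vector of the chain restricted to a sublevel set, together with a
lower bound for the mass of the set where the drift may be positive. -/
theorem exists_sublevel_vector (hq : ∀ x, exitRate q x ≠ ∞) {V : S → ℝ} (hV : ∀ x, 0 ≤ V x)
    {ε : ℝ} (hε : 0 ≤ ε) {g : S → ℝ} (hg : ∀ x, 0 ≤ g x)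
    (hdrift : ∀ x, ∑' w, q x w * ENNReal.ofReal (V w) + ENNReal.ofReal ε ≤
      ENNReal.ofReal ((exitRate q x).toReal * V x + g x)) {N : ℝ} {A : Finset S}
    (hA : ∀ x, x ∈ A ↔ V x ≤ N) (hne : A.Nonempty) :
    ∃ p : S → ℝ, (∀ x, 0 ≤ p x) ∧ (∀ x ∉ A, p x = 0) ∧ ∑ x ∈ A, p x = 1 ∧
      (∀ y ∈ A, ∑ x ∈ A, p x * (q x y).toReal ≤ p y * (exitRate q y).toReal) ∧
      ε ≤ ∑ x ∈ A, p x * g x := by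
  classical
  have : Nonempty A := hne.to_subtype
  obtain ⟨p, hp0, hp1, hp⟩ := exists_invariant_vector (ι := A)
    (r := fun x y => (q x y).toReal) fun x y => ENNReal.toReal_nonneg
  set P : S → ℝ := fun x => if h : x ∈ A then p ⟨x, h⟩ else 0 with hP
  have hPA : ∀ x : A, P x = p x := fun x => by simp [hP]
  have hbal : ∀ y ∈ A, ∑ x ∈ A, P x * (q x y).toReal = P y * ∑ w ∈ A, (q y w).toReal := by
    intro y hy
    have h := hp ⟨y, hy⟩
    simp_rw [← hPA] at h
    rw [Finset.sum_coe_sort A fun x => P x * (q x y).toReal,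
      Finset.sum_coe_sort A fun w => (q y w).toReal] at h
    exact h
  have hP0 : ∀ x, 0 ≤ P x := fun x => by
    simp only [hP]
    split_ifs
    · exact hp0 _
    · exact le_rfl
  have hP1 : ∑ x ∈ A, P x = 1 := by
    rw [← Finset.sum_coe_sort A P, ← hp1]
    exact Finset.sum_congr rfl fun x _ => hPA x
  refine ⟨P, hP0, fun x hx => by simp [hP, hx], hP1, fun y hy => ?_, ?_⟩
  · rw [hbal y hy]
    refine mul_le_mul_of_nonneg_left ?_ (hP0 y)
    have hqfin : ∀ w, q y w ≠ ∞ := fun w => ne_top_of_le_ne_top (hq y) (ENNReal.le_tsum w)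
    rw [exitRate, ENNReal.tsum_toReal_eq hqfin]
    exact (ENNReal.summable_toReal (hq y)).sum_le_tsum A fun w _ => ENNReal.toReal_nonneg
  -- Stationarity: the mean of the restricted generator applied to `V` vanishes.
  · have hzero : ∑ x ∈ A, P x * ∑ w ∈ A, (q x w).toReal * (V w - V x) = 0 := by
      have h1 : ∑ x ∈ A, P x * ∑ w ∈ A, (q x w).toReal * V w =
          ∑ x ∈ A, V x * (P x * ∑ w ∈ A, (q x w).toReal) := by
        simp_rw [Finset.mul_sum]
        rw [Finset.sum_comm]
        refine Finset.sum_congr rfl fun y hy => ?_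
        rw [← Finset.mul_sum, ← Finset.mul_sum, ← hbal y hy, Finset.mul_sum]
        exact Finset.sum_congr rfl fun x _ => by ring
      simp_rw [mul_sub, Finset.sum_sub_distrib, mul_sub, Finset.sum_sub_distrib]
      rw [h1, sub_eq_zero]
      refine Finset.sum_congr rfl fun x _ => ?_
      rw [← Finset.sum_mul]
      ring
    have hle : ∑ x ∈ A, P x * ∑ w ∈ A, (q x w).toReal * (V w - V x) ≤
        ∑ x ∈ A, P x * (g x - ε) := Finset.sum_le_sum fun x hx =>
      mul_le_mul_of_nonneg_left (sum_sublevel_drift hq hV hε hg hdrift hA hx) (hP0 x)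
    rw [hzero] at hle
    simp_rw [mul_sub, Finset.sum_sub_distrib] at hle
    rw [← Finset.sum_mul, hP1] at hle
    linarith

/-- Foster's criterion: if the drift of `V` is at most `-ε` outside a finite set, then there is a
subinvariant probability vector. -/
theorem exists_subinvariant_of_drift [Countable S] [Nonempty S] (hq : ∀ x, exitRate q x ≠ ∞)
    {V : S → ℝ} (hV : ∀ x, 0 ≤ V x) (hfin : ∀ N : ℝ, {x | V x ≤ N}.Finite)
    {ε : ℝ} (hε : 0 < ε) {g : S → ℝ} (hg : ∀ x, 0 ≤ g x) (hgfin : g.support.Finite)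
    (hdrift : ∀ x, ∑' w, q x w * ENNReal.ofReal (V w) + ENNReal.ofReal ε ≤
      ENNReal.ofReal ((exitRate q x).toReal * V x + g x)) :
    ∃ p : S → ℝ≥0∞, ∑' x, p x = 1 ∧ ∀ y, ∑' x, p x * q x y ≤ p y * exitRate q y := by
  classical
  obtain ⟨x₀⟩ := ‹Nonempty S›
  obtain ⟨N₀, hN₀⟩ := exists_nat_ge (V x₀)
  set A : ℕ → Finset S := fun N => (hfin ((N + N₀ : ℕ) : ℝ)).toFinset with hAdef
  have hA : ∀ N x, x ∈ A N ↔ V x ≤ ((N + N₀ : ℕ) : ℝ) := fun N x => by simp [hAdef]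
  have hAne : ∀ N, (A N).Nonempty := fun N => ⟨x₀, (hA N x₀).2 <| by
    push_cast
    linarith [N.cast_nonneg (α := ℝ)]⟩
  choose p hp0 hpA hp1 hpq hpg using fun N =>
    exists_sublevel_vector hq hV hε.le hg hdrift (hA N) (hAne N)
  have hAev : ∀ F : Finset S, ∀ᶠ N in atTop, F ⊆ A N := by
    intro F
    refine (Filter.eventually_all_finset F).2 fun x _ => ?_
    obtain ⟨n, hn⟩ := exists_nat_ge (V x)
    filter_upwards [eventually_ge_atTop n] with N hN
    refine (hA N x).2 (hn.trans ?_)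
    exact_mod_cast hN.trans (Nat.le_add_right _ _)
  have hple : ∀ N, ∀ F : Finset S, ∑ x ∈ F, p N x ≤ 1 := by
    intro N F
    calc ∑ x ∈ F, p N x ≤ ∑ x ∈ F ∪ A N, p N x :=
          Finset.sum_le_sum_of_subset_of_nonneg Finset.subset_union_left fun x _ _ => hp0 N x
      _ = ∑ x ∈ A N, p N x := (Finset.sum_subset Finset.subset_union_right
          fun x _ hx => hpA N x hx).symm
      _ = 1 := hp1 N
  -- Mass may escape in the pointwise limit `a`, but the bound `haK` survives because `g` has finite
  -- support, and it excludes `a = 0`.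
  have hcpt : IsCompact (Set.univ.pi fun _ : S => Set.Icc (0 : ℝ) 1) :=
    isCompact_univ_pi fun _ => isCompact_Icc
  obtain ⟨a, ha, φ, hφ, hlim⟩ := hcpt.tendsto_subseq (x := p) fun N x _ =>
    ⟨hp0 N x, by simpa using hple N {x}⟩
  have hlimx : ∀ x, Tendsto (fun N => p (φ N) x) atTop (𝓝 (a x)) := fun x =>
    (tendsto_pi_nhds.1 hlim) x
  have ha0 : ∀ x, 0 ≤ a x := fun x => (ha x (Set.mem_univ x)).1
  have hasub : ∀ (F : Finset S) (y : S),
      ∑ x ∈ F, a x * (q x y).toReal ≤ a y * (exitRate q y).toReal := by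
    intro F y
    refine le_of_tendsto_of_tendsto (tendsto_finsetSum F fun x _ => (hlimx x).mul_const _)
      ((hlimx y).mul_const _) ?_
    filter_upwards [hφ.tendsto_atTop.eventually (hAev (insert y F))] with N hN
    refine le_trans (Finset.sum_le_sum_of_subset_of_nonneg
      ((Finset.subset_insert y F).trans hN) fun x _ _ =>
        mul_nonneg (hp0 _ x) ENNReal.toReal_nonneg) ?_
    exact hpq (φ N) y (hN (Finset.mem_insert_self y F))
  have haK : ε ≤ ∑ x ∈ hgfin.toFinset, a x * g x := by
    refine ge_of_tendsto (tendsto_finsetSum _ fun x _ => (hlimx x).mul_const _)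
      (Eventually.of_forall fun N => (hpg (φ N)).trans ?_)
    calc ∑ x ∈ A (φ N), p (φ N) x * g x
        ≤ ∑ x ∈ A (φ N) ∪ hgfin.toFinset, p (φ N) x * g x :=
          Finset.sum_le_sum_of_subset_of_nonneg Finset.subset_union_left
            fun x _ _ => mul_nonneg (hp0 _ x) (hg x)
      _ = _ := (Finset.sum_subset Finset.subset_union_right fun x _ hx => by
          have : g x = 0 := by simpa using hx
          simp [this]).symm
  have ha1 : ∑' x, ENNReal.ofReal (a x) ≤ 1 := by
    rw [ENNReal.tsum_eq_iSup_sum]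
    refine iSup_le fun F => ?_
    rw [← ENNReal.ofReal_sum_of_nonneg fun x _ => ha0 x, ENNReal.ofReal_le_one]
    exact le_of_tendsto' (tendsto_finsetSum F fun x _ => hlimx x) fun N => hple _ F
  have hapos : ∑' x, ENNReal.ofReal (a x) ≠ 0 := by
    intro h
    rw [ENNReal.tsum_eq_zero] at h
    have hzero : ∀ x, a x = 0 := fun x =>
      le_antisymm (ENNReal.ofReal_eq_zero.1 (h x)) (ha0 x)
    simp only [hzero, zero_mul, Finset.sum_const_zero] at haK
    exact absurd haK (not_le.2 hε)
  have hatop : ∑' x, ENNReal.ofReal (a x) ≠ ∞ := ne_top_of_le_ne_top ENNReal.one_ne_top ha1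
  refine ⟨fun x => ENNReal.ofReal (a x) / ∑' x, ENNReal.ofReal (a x), ?_, fun y => ?_⟩
  · simp_rw [div_eq_mul_inv]
    rw [ENNReal.tsum_mul_right, ENNReal.mul_inv_cancel hapos hatop]
  · simp_rw [div_eq_mul_inv, mul_right_comm _ (_ : ℝ≥0∞)⁻¹]
    rw [ENNReal.tsum_mul_right]
    gcongr
    rw [ENNReal.tsum_eq_iSup_sum]
    refine iSup_le fun F => ?_
    have hqfin : ∀ x, q x y ≠ ∞ := fun x => ne_top_of_le_ne_top (hq x) (ENNReal.le_tsum y)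
    calc ∑ x ∈ F, ENNReal.ofReal (a x) * q x y
        = ENNReal.ofReal (∑ x ∈ F, a x * (q x y).toReal) := by
          rw [ENNReal.ofReal_sum_of_nonneg fun x _ => mul_nonneg (ha0 x) ENNReal.toReal_nonneg]
          refine Finset.sum_congr rfl fun x _ => ?_
          rw [ENNReal.ofReal_mul (ha0 x), ENNReal.ofReal_toReal (hqfin x)]
      _ ≤ ENNReal.ofReal (a y * (exitRate q y).toReal) := ENNReal.ofReal_le_ofReal (hasub F y)
      _ = _ := by rw [ENNReal.ofReal_mul (ha0 y), ENNReal.ofReal_toReal (hq y)]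

end MarkovChain

namespace MulticlassQueue

open MarkovChain

variable {m : ℕ}

/-! ### The generator of the queue -/

/-- The total rate `μ_i z_i + γ_i (x_i - z_i)` at which class `i` customers leave. -/
def departureRate (mu gam : Fin m → ℝ) (z : (Fin m → ℕ) → Fin m → ℕ) (x : Fin m → ℕ)
    (i : Fin m) : ℝ :=
  mu i * (z x i : ℝ) + gam i * ((x i : ℝ) - (z x i : ℝ))

/-- The generator of the queue. -/
def generator (lam mu gam : Fin m → ℝ) (z : (Fin m → ℕ) → Fin m → ℕ) (f : (Fin m → ℕ) → ℝ)
    (x : Fin m → ℕ) : ℝ :=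
  ∑ i, lam i * (f (x + Pi.single i 1) - f x) +
    ∑ i, departureRate mu gam z x i * (f (x - Pi.single i 1) - f x)

section Rates

variable {lam mu gam : Fin m → ℝ} {z : (Fin m → ℕ) → Fin m → ℕ}

theorem departureRate_nonneg (hmu : ∀ i, 0 ≤ mu i) (hgam : ∀ i, 0 ≤ gam i)
    (hz : ∀ x i, z x i ≤ x i) (x : Fin m → ℕ) (i : Fin m) : 0 ≤ departureRate mu gam z x i := by
  have h : (z x i : ℝ) ≤ x i := by exact_mod_cast hz x i
  exact add_nonneg (mul_nonneg (hmu i) (Nat.cast_nonneg _)) (mul_nonneg (hgam i) (by linarith))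

theorem departureRate_eq_zero (hz : ∀ x i, z x i ≤ x i) {x : Fin m → ℕ} {i : Fin m}
    (hx : x i = 0) : departureRate mu gam z x i = 0 := by
  have h : z x i = 0 := Nat.le_zero.1 (hx ▸ hz x i)
  simp [departureRate, hx, h]

theorem sub_single_add_single {x : Fin m → ℕ} {i : Fin m} (hx : x i ≠ 0) :
    x - Pi.single i 1 + Pi.single i 1 = x := by
  ext j
  by_cases h : j = i
  · subst h
    simp
    omega
  · simp [h]

theorem tsum_jumpRate_mul (hz : ∀ x i, z x i ≤ x i) (f : (Fin m → ℕ) → ℝ≥0∞) (x : Fin m → ℕ) :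
    ∑' y, jumpRate lam mu gam z x y * f y =
      ∑ i, ENNReal.ofReal (lam i) * f (x + Pi.single i 1) +
        ∑ i, ENNReal.ofReal (departureRate mu gam z x i) * f (x - Pi.single i 1) := by
  classical
  simp_rw [jumpRate, add_mul, Finset.sum_mul]
  rw [ENNReal.tsum_add, Summable.tsum_finsetSum fun _ _ => ENNReal.summable,
    Summable.tsum_finsetSum fun _ _ => ENNReal.summable]
  congr 1
  · refine Finset.sum_congr rfl fun i _ => ?_
    rw [tsum_eq_single (x + Pi.single i 1) fun y hy => by simp [hy]]
    simp
  · refine Finset.sum_congr rfl fun i _ => ?_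
    -- Truncated subtraction gives `x - Pi.single i 1 = x` here; the departure rate is zero, so the
    -- value is irrelevant.
    by_cases hx : x i = 0
    · rw [departureRate_eq_zero hz hx, ENNReal.ofReal_zero, zero_mul, ENNReal.tsum_eq_zero]
      intro y
      rw [if_neg, zero_mul]
      intro h
      have := congrFun h i
      simp [hx] at this
    · rw [tsum_eq_single (x - Pi.single i 1)]
      · rw [if_pos (sub_single_add_single hx).symm]
        rfl
      · intro y hy
        rw [if_neg, zero_mul]
        intro h
        exact hy (by rw [h, add_tsub_cancel_right])

theorem exitRate_jumpRate (hlam : ∀ i, 0 ≤ lam i) (hmu : ∀ i, 0 ≤ mu i) (hgam : ∀ i, 0 ≤ gam i)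
    (hz : ∀ x i, z x i ≤ x i) (x : Fin m → ℕ) :
    exitRate (jumpRate lam mu gam z) x =
      ENNReal.ofReal (∑ i, lam i + ∑ i, departureRate mu gam z x i) := by
  have h := tsum_jumpRate_mul (lam := lam) (mu := mu) (gam := gam) hz 1 x
  simp only [Pi.one_apply, mul_one] at h
  have hd := departureRate_nonneg hmu hgam hz x
  rw [exitRate, h, ENNReal.ofReal_add (Finset.sum_nonneg fun i _ => hlam i)
    (Finset.sum_nonneg fun i _ => hd i), ENNReal.ofReal_sum_of_nonneg fun i _ => hlam i,
    ENNReal.ofReal_sum_of_nonneg fun i _ => hd i]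

theorem exitRate_jumpRate_ne_top (hlam : ∀ i, 0 ≤ lam i) (hmu : ∀ i, 0 ≤ mu i)
    (hgam : ∀ i, 0 ≤ gam i) (hz : ∀ x i, z x i ≤ x i) (x : Fin m → ℕ) :
    exitRate (jumpRate lam mu gam z) x ≠ ∞ := by
  rw [exitRate_jumpRate hlam hmu hgam hz]
  exact ENNReal.ofReal_ne_top

theorem toReal_exitRate_jumpRate (hlam : ∀ i, 0 ≤ lam i) (hmu : ∀ i, 0 ≤ mu i)
    (hgam : ∀ i, 0 ≤ gam i) (hz : ∀ x i, z x i ≤ x i) (x : Fin m → ℕ) :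
    (exitRate (jumpRate lam mu gam z) x).toReal =
      ∑ i, lam i + ∑ i, departureRate mu gam z x i := by
  rw [exitRate_jumpRate hlam hmu hgam hz, ENNReal.toReal_ofReal]
  exact add_nonneg (Finset.sum_nonneg fun i _ => hlam i)
    (Finset.sum_nonneg fun i _ => departureRate_nonneg hmu hgam hz x i)

theorem exitRate_mul_add_generator (hlam : ∀ i, 0 ≤ lam i) (hmu : ∀ i, 0 ≤ mu i)
    (hgam : ∀ i, 0 ≤ gam i) (hz : ∀ x i, z x i ≤ x i) (f : (Fin m → ℕ) → ℝ) (x : Fin m → ℕ) :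
    (exitRate (jumpRate lam mu gam z) x).toReal * f x + generator lam mu gam z f x =
      ∑ i, lam i * f (x + Pi.single i 1) +
        ∑ i, departureRate mu gam z x i * f (x - Pi.single i 1) := by
  rw [toReal_exitRate_jumpRate hlam hmu hgam hz, generator]
  simp_rw [mul_sub, Finset.sum_sub_distrib, ← Finset.sum_mul]
  ring

theorem exitRate_mul_add_generator_nonneg (hlam : ∀ i, 0 ≤ lam i) (hmu : ∀ i, 0 ≤ mu i)
    (hgam : ∀ i, 0 ≤ gam i) (hz : ∀ x i, z x i ≤ x i) {f : (Fin m → ℕ) → ℝ} (hf : ∀ x, 0 ≤ f x)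
    (x : Fin m → ℕ) :
    0 ≤ (exitRate (jumpRate lam mu gam z) x).toReal * f x + generator lam mu gam z f x := by
  rw [exitRate_mul_add_generator hlam hmu hgam hz]
  exact add_nonneg (Finset.sum_nonneg fun i _ => mul_nonneg (hlam i) (hf _))
    (Finset.sum_nonneg fun i _ => mul_nonneg (departureRate_nonneg hmu hgam hz x i) (hf _))

theorem tsum_jumpRate_mul_ofReal (hlam : ∀ i, 0 ≤ lam i) (hmu : ∀ i, 0 ≤ mu i)
    (hgam : ∀ i, 0 ≤ gam i) (hz : ∀ x i, z x i ≤ x i) {f : (Fin m → ℕ) → ℝ} (hf : ∀ x, 0 ≤ f x)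
    (x : Fin m → ℕ) :
    ∑' y, jumpRate lam mu gam z x y * ENNReal.ofReal (f y) =
      ENNReal.ofReal ((exitRate (jumpRate lam mu gam z) x).toReal * f x +
        generator lam mu gam z f x) := by
  have hd := departureRate_nonneg hmu hgam hz x
  rw [tsum_jumpRate_mul hz, exitRate_mul_add_generator hlam hmu hgam hz,
    ENNReal.ofReal_add (Finset.sum_nonneg fun i _ => mul_nonneg (hlam i) (hf _))
      (Finset.sum_nonneg fun i _ => mul_nonneg (hd i) (hf _)),
    ENNReal.ofReal_sum_of_nonneg fun i _ => mul_nonneg (hlam i) (hf _),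
    ENNReal.ofReal_sum_of_nonneg fun i _ => mul_nonneg (hd i) (hf _)]
  simp_rw [ENNReal.ofReal_mul (hlam _), ENNReal.ofReal_mul (hd _)]

theorem drift_of_generator_le (hlam : ∀ i, 0 ≤ lam i) (hmu : ∀ i, 0 ≤ mu i)
    (hgam : ∀ i, 0 ≤ gam i) (hz : ∀ x i, z x i ≤ x i) {f : (Fin m → ℕ) → ℝ} (hf : ∀ x, 0 ≤ f x)
    {x : Fin m → ℕ} {a b : ℝ} (ha : 0 ≤ a) (h : generator lam mu gam z f x + a ≤ b) :
    ∑' y, jumpRate lam mu gam z x y * ENNReal.ofReal (f y) + ENNReal.ofReal a ≤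
      ENNReal.ofReal ((exitRate (jumpRate lam mu gam z) x).toReal * f x + b) := by
  rw [tsum_jumpRate_mul_ofReal hlam hmu hgam hz hf,
    ← ENNReal.ofReal_add (exitRate_mul_add_generator_nonneg hlam hmu hgam hz hf x) ha]
  exact ENNReal.ofReal_le_ofReal (by linarith)

/-- The generator on linear functions. -/
theorem generator_linear (hz : ∀ x i, z x i ≤ x i) (a : Fin m → ℝ) (b : ℝ) (x : Fin m → ℕ) :
    generator lam mu gam z (fun x => b + ∑ j, a j * (x j : ℝ)) x =
      ∑ i, lam i * a i - ∑ i, departureRate mu gam z x i * a i := by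
  have hadd : ∀ (y : Fin m → ℕ) (i : Fin m),
      ∑ j, a j * (((y + Pi.single i 1 : Fin m → ℕ) j : ℕ) : ℝ) = ∑ j, a j * (y j : ℝ) + a i := by
    intro y i
    simp [mul_add, Finset.sum_add_distrib, Pi.single_apply]
  rw [generator, sub_eq_add_neg, ← Finset.sum_neg_distrib]
  congr 1
  · refine Finset.sum_congr rfl fun i _ => ?_
    rw [hadd]
    ring
  · refine Finset.sum_congr rfl fun i _ => ?_
    by_cases hx : x i = 0
    · simp [departureRate_eq_zero hz hx]
    · have h := hadd (x - Pi.single i 1) i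
      rw [sub_single_add_single hx] at h
      rw [h]
      ring

/-! ### Irreducibility -/

theorem jumpRate_add_single_ne_zero (hlam : ∀ i, 0 < lam i) (x : Fin m → ℕ) (i : Fin m) :
    jumpRate lam mu gam z x (x + Pi.single i 1) ≠ 0 := by
  classical
  intro h
  rw [jumpRate, add_eq_zero, Finset.sum_eq_zero_iff] at h
  have := h.1 i (Finset.mem_univ i)
  simp [(hlam i).not_ge] at this

theorem jumpRate_sub_single_ne_zero {x : Fin m → ℕ} {i : Fin m} (hx : x i ≠ 0)
    (hd : 0 < departureRate mu gam z x i) :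
    jumpRate lam mu gam z x (x - Pi.single i 1) ≠ 0 := by
  classical
  intro h
  rw [jumpRate, add_eq_zero, Finset.sum_eq_zero_iff, Finset.sum_eq_zero_iff] at h
  have h2 := h.2 i (Finset.mem_univ i)
  rw [if_pos (sub_single_add_single hx).symm, ENNReal.ofReal_eq_zero] at h2
  exact absurd h2 (not_le.2 hd)

theorem sum_sub_single {x : Fin m → ℕ} {i : Fin m} (hx : x i ≠ 0) :
    ∑ j, (x - Pi.single i 1 : Fin m → ℕ) j + 1 = ∑ j, x j := by
  conv_rhs => rw [← sub_single_add_single hx]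
  simp only [Pi.add_apply]
  rw [Finset.sum_add_distrib, Finset.sum_pi_single']
  simp

/-- Paths go through `0`. On the way down, work conservation with at least one server keeps some job
in service in every nonempty state, so a departure is possible even when `gam` vanishes. -/
theorem reflTransGen_jumpRate {n : ℕ} (hn : 0 < n) (hlam : ∀ i, 0 < lam i) (hmu : ∀ i, 0 < mu i)
    (hgam : ∀ i, 0 ≤ gam i) (hz : WorkConserving n z) (x y : Fin m → ℕ) :
    Relation.ReflTransGen (fun x y => jumpRate lam mu gam z x y ≠ 0) x y := by
  have hdown : ∀ k : ℕ, ∀ x : Fin m → ℕ, ∑ i, x i = k →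
      Relation.ReflTransGen (fun x y => jumpRate lam mu gam z x y ≠ 0) x 0 := by
    intro k
    induction k with
    | zero =>
      intro x hx
      have : x = 0 := funext fun i => by simpa using (Finset.sum_eq_zero_iff.1 hx) i
      rw [this]
    | succ k ih =>
      intro x hx
      have hsum : ∑ i, z x i ≠ 0 := by
        rw [hz.sum_eq, hx]
        omega
      obtain ⟨i, -, hi⟩ := Finset.exists_ne_zero_of_sum_ne_zero hsum
      have hle := hz.le_state x i
      have hxi : x i ≠ 0 := by omega
      have hd : 0 < departureRate mu gam z x i := by
        have h1 : (z x i : ℝ) ≤ x i := by exact_mod_cast hle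
        have h2 : (0 : ℝ) < z x i := by exact_mod_cast Nat.pos_of_ne_zero hi
        exact add_pos_of_pos_of_nonneg (mul_pos (hmu i) h2) (mul_nonneg (hgam i) (by linarith))
      refine Relation.ReflTransGen.head (jumpRate_sub_single_ne_zero hxi hd) (ih _ ?_)
      have := sum_sub_single hxi
      omega
  have hup : ∀ k : ℕ, ∀ x : Fin m → ℕ, ∑ i, x i = k →
      Relation.ReflTransGen (fun x y => jumpRate lam mu gam z x y ≠ 0) 0 x := by
    intro k
    induction k with
    | zero =>
      intro x hx
      have : x = 0 := funext fun i => by simpa using (Finset.sum_eq_zero_iff.1 hx) i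
      rw [this]
    | succ k ih =>
      intro x hx
      obtain ⟨i, -, hi⟩ := Finset.exists_ne_zero_of_sum_ne_zero (by omega : ∑ i, x i ≠ 0)
      have := sum_sub_single hi
      refine Relation.ReflTransGen.tail (ih (x - Pi.single i 1) (by omega)) ?_
      have h := jumpRate_add_single_ne_zero (mu := mu) (gam := gam) (z := z) hlam
        (x - Pi.single i 1) i
      rwa [sub_single_add_single hi] at h
  exact (hdown _ x rfl).trans (hup _ y rfl)

/-! ### Existence and uniqueness of the invariant distribution -/

/-- Foster's criterion with the workload `V = ∑ x_j/μ_j`. Abandonment only helps, so `V` decreases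
at rate at least `∑ z_i = min(n, ∑ x_i)`, which is `n` outside the finite set of states with fewer
than `n` jobs. -/
theorem exists_isInvariant {n : ℕ} (hlam : ∀ i, 0 ≤ lam i) (hmu : ∀ i, 0 < mu i)
    (hgam : ∀ i, 0 ≤ gam i) (hload : ∑ i, lam i / mu i < n) (hz : WorkConserving n z) :
    ∃ π : Measure (Fin m → ℕ), IsInvariant (jumpRate lam mu gam z) π := by
  classical
  have hz' := hz.le_state
  have hmu' : ∀ i, 0 ≤ mu i := fun i => (hmu i).le
  have hq := exitRate_jumpRate_ne_top hlam hmu' hgam hz'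
  have hd := departureRate_nonneg hmu' hgam hz'
  have hone : ∀ t : ℝ, 0 ≤ t → ∀ x, ∑' y, transition (jumpRate lam mu gam z) t x y = 1 := by
    intro t ht x
    -- With `W = 1 + ∑ x_j`, the exit rate is at most `c W`, and the generator of `W` is at most `∑
    -- λ_i ≤ c W`.
    set c := ∑ i, lam i + ∑ i, (mu i + gam i) with hc
    have hl0 : 0 ≤ ∑ i, lam i := Finset.sum_nonneg fun i _ => hlam i
    have hm0 : 0 ≤ ∑ i, (mu i + gam i) := Finset.sum_nonneg fun i _ => add_nonneg (hmu' i) (hgam i)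
    have hc0 : 0 ≤ c := add_nonneg hl0 hm0
    have hW : ∀ x : Fin m → ℕ, 1 ≤ 1 + ∑ j, (1 : ℝ) * (x j : ℝ) := fun x =>
      le_add_of_nonneg_right (Finset.sum_nonneg fun i _ => by positivity)
    have hW0 : ∀ x : Fin m → ℕ, 0 ≤ 1 + ∑ j, (1 : ℝ) * (x j : ℝ) := fun x =>
      zero_le_one.trans (hW x)
    refine tsum_transition_eq_one hq (W := fun x => 1 + ∑ j, (1 : ℝ) * (x j : ℝ)) hW0 hc0
      (fun x => ?_) (fun x => ?_) ht x
    · rw [toReal_exitRate_jumpRate hlam hmu' hgam hz', hc, add_mul]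
      refine add_le_add (le_mul_of_one_le_right hl0 (hW x)) ?_
      rw [Finset.sum_mul]
      refine Finset.sum_le_sum fun i _ => ?_
      have hxi : (x i : ℝ) ≤ 1 + ∑ j, (1 : ℝ) * (x j : ℝ) := by
        have := Finset.single_le_sum (f := fun j => (1 : ℝ) * (x j : ℝ))
          (fun j _ => by positivity) (Finset.mem_univ i)
        simp only [one_mul] at this ⊢
        linarith
      have hzi : (z x i : ℝ) ≤ x i := by exact_mod_cast hz' x i
      calc departureRate mu gam z x i ≤ mu i * (x i : ℝ) + gam i * (x i : ℝ) := by
            unfold departureRate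
            gcongr
            · exact hmu' i
            · exact hgam i
            · exact sub_le_self _ (Nat.cast_nonneg _)
        _ = (mu i + gam i) * (x i : ℝ) := by ring
        _ ≤ _ := mul_le_mul_of_nonneg_left hxi (add_nonneg (hmu' i) (hgam i))
    · rw [tsum_jumpRate_mul_ofReal hlam hmu' hgam hz' hW0]
      refine ENNReal.ofReal_le_ofReal ?_
      rw [generator_linear hz', add_mul]
      gcongr
      have h1 : 0 ≤ ∑ i, departureRate mu gam z x i * 1 :=
        Finset.sum_nonneg fun i _ => mul_nonneg (hd x i) zero_le_one
      have h2 : ∑ i, lam i * 1 ≤ c := by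
        simp only [mul_one]
        linarith
      nlinarith [hW x]
  have hV0 : ∀ x : Fin m → ℕ, 0 ≤ 0 + ∑ j, (mu j)⁻¹ * (x j : ℝ) := fun x => by
    rw [zero_add]
    exact Finset.sum_nonneg fun j _ => mul_nonneg (inv_nonneg.2 (hmu' j)) (Nat.cast_nonneg _)
  obtain ⟨p, hp1, hp⟩ := exists_subinvariant_of_drift hq
    (V := fun x => 0 + ∑ j, (mu j)⁻¹ * (x j : ℝ)) hV0
    (fun N => by
      refine (Set.finite_Iic fun i => ⌈mu i * N⌉₊).subset fun x hx i => ?_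
      have h1 := Finset.single_le_sum (f := fun j => (mu j)⁻¹ * (x j : ℝ))
        (fun j _ => mul_nonneg (inv_nonneg.2 (hmu' j)) (Nat.cast_nonneg _)) (Finset.mem_univ i)
      simp only [Set.mem_ofPred_eq, zero_add] at hx
      have h2 := h1.trans hx
      rw [inv_mul_le_iff₀ (hmu i)] at h2
      exact_mod_cast h2.trans (Nat.le_ceil _))
    (ε := n - ∑ i, lam i / mu i) (by linarith)
    -- With fewer than `n` jobs the drift is at most `∑ λ_i/μ_i`; adding `ε` gives exactly `n`.
    (g := fun x => if ∑ i, x i < n then (n : ℝ) else 0) (fun x => by split_ifs <;> simp)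
    (by
      refine (Set.finite_Iic fun _ => n).subset fun x hx i => ?_
      have hlt : ∑ i, x i < n := by
        by_contra h
        simp [h] at hx
      exact (Finset.single_le_sum (fun j _ => Nat.zero_le (x j)) (Finset.mem_univ i)).trans hlt.le)
    (fun x => by
      refine drift_of_generator_le hlam hmu' hgam hz' hV0 (by linarith) ?_
      rw [generator_linear hz']
      have h1 : (∑ i, (z x i : ℝ)) ≤ ∑ i, departureRate mu gam z x i * (mu i)⁻¹ := by
        refine Finset.sum_le_sum fun i _ => ?_
        rw [← div_eq_mul_inv, le_div_iff₀ (hmu i), departureRate]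
        have hzi : (z x i : ℝ) ≤ x i := by exact_mod_cast hz' x i
        nlinarith [mul_nonneg (hgam i) (sub_nonneg.2 hzi)]
      have h2 : (∑ i, (z x i : ℝ)) = min (n : ℝ) (∑ i, x i : ℕ) := by
        exact_mod_cast hz.sum_eq x
      simp_rw [← div_eq_mul_inv] at h1 ⊢
      split_ifs with h
      · have h3 : (0 : ℝ) ≤ ∑ i, (z x i : ℝ) := Finset.sum_nonneg fun i _ => Nat.cast_nonneg _
        linarith
      · rw [min_eq_left (by exact_mod_cast not_lt.1 h)] at h2
        linarith)
  exact exists_isInvariant_of_subinvariant hq hone hp1 hp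

theorem existsUnique_isInvariant {n : ℕ} (hlam : ∀ i, 0 < lam i) (hmu : ∀ i, 0 < mu i)
    (hgam : ∀ i, 0 ≤ gam i) (hload : ∑ i, lam i / mu i < n) (hz : WorkConserving n z) :
    ∃! π : Measure (Fin m → ℕ), IsInvariant (jumpRate lam mu gam z) π := by
  have hn : 0 < n := by
    have h : 0 ≤ ∑ i, lam i / mu i := Finset.sum_nonneg fun i _ =>
      div_nonneg (hlam i).le (hmu i).le
    exact_mod_cast h.trans_lt hload
  obtain ⟨π, hπ⟩ := exists_isInvariant (fun i => (hlam i).le) hmu hgam hload hz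
  refine ⟨π, hπ, fun π' hπ' => ?_⟩
  exact hπ'.eq_of_irreducible (exitRate_jumpRate_ne_top (fun i => (hlam i).le)
    (fun i => (hmu i).le) hgam hz.le_state) (reflTransGen_jumpRate hn hlam hmu hgam hz) hπ

end Rates

/-! ### Exponential moments of the negative part -/

/-- The constant in the drift inequality for `exp (-θ y)`. -/
def expDriftConst (θ L M μ₀ R : ℝ) : ℝ :=
  Real.exp (θ * R) * (L * θ ^ 2 * Real.exp θ + 1 + M * Real.exp θ) *
    Real.exp ((L * θ ^ 2 * Real.exp θ + 1) / μ₀)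

theorem expDriftConst_nonneg {θ L M : ℝ} (hL : 0 ≤ L) (hM : 0 ≤ M) (μ₀ R : ℝ) :
    0 ≤ expDriftConst θ L M μ₀ R := by
  unfold expDriftConst
  positivity

/-- For `a ≥ 0` the factor `exp (-θ a)` absorbs the linear growth. For `a < 0` positivity of the
bracket forces `-θ a ≤ (A + 1)/μ₀`, so the exponential is bounded. -/
theorem exp_neg_mul_affine_le {θ A M μ₀ mu a κ K : ℝ} (hθ : 0 < θ) (hA : 0 ≤ A) (hμ₀ : 0 < μ₀)
    (hmu₀ : μ₀ ≤ mu) (hmuM : mu ≤ M) (hκ : θ ≤ κ) (hκK : κ ≤ θ * K)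
    (hpos : 0 < A + 1 + mu * a * κ) :
    Real.exp (-(θ * a)) * (A + 1 + mu * a * κ) ≤ (A + 1 + M * K) * Real.exp ((A + 1) / μ₀) := by
  have hκ0 : 0 < κ := hθ.trans_le hκ
  have hM : 0 < M := hμ₀.trans_le (hmu₀.trans hmuM)
  have hK : 0 < K := pos_of_mul_pos_right (hκ0.trans_le hκK) hθ.le
  have hMK : 0 < M * K := mul_pos hM hK
  rcases le_or_gt 0 a with ha | ha
  · have h1 : mu * a * κ ≤ M * a * (θ * K) := by gcongr
    have h2 : 0 ≤ (A + 1) * (θ * a) := by positivity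
    have h3 : A + 1 + mu * a * κ ≤ (A + 1 + M * K) * (1 + θ * a) := by linarith
    have h4 : 1 + θ * a ≤ Real.exp (θ * a) := by linarith [Real.add_one_le_exp (θ * a)]
    calc Real.exp (-(θ * a)) * (A + 1 + mu * a * κ)
        ≤ Real.exp (-(θ * a)) * ((A + 1 + M * K) * Real.exp (θ * a)) := by
          gcongr
          exact h3.trans (by gcongr)
      _ = (A + 1 + M * K) * (Real.exp (-(θ * a)) * Real.exp (θ * a)) := by ring
      _ = (A + 1 + M * K) * 1 := by rw [← Real.exp_add]; simp
      _ ≤ _ := by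
          gcongr
          exact Real.one_le_exp (by positivity)
  · have h1 : μ₀ * θ ≤ mu * κ := mul_le_mul hmu₀ hκ hθ.le (hμ₀.le.trans hmu₀)
    have h2 : a * (mu * κ) ≤ a * (μ₀ * θ) := mul_le_mul_of_nonpos_left h1 ha.le
    have h3 : a * (mu * κ) ≤ 0 := mul_nonpos_of_nonpos_of_nonneg ha.le
      ((mul_pos hμ₀ hθ).le.trans h1)
    have h4 : -(θ * a) ≤ (A + 1) / μ₀ := by
      rw [le_div_iff₀ hμ₀]
      linarith
    have h5 : A + 1 + mu * a * κ ≤ A + 1 + M * K := by linarith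
    calc Real.exp (-(θ * a)) * (A + 1 + mu * a * κ)
        ≤ Real.exp ((A + 1) / μ₀) * (A + 1 + M * K) := by gcongr
      _ = _ := mul_comm _ _

/-- A birth and death process with birth rate `lam` and death rate at most `mu * x` drifts towards
the origin when centered at `lam / mu` and far to the left. -/
theorem exp_drift_le {θ L M μ₀ R n lam mu d x r y : ℝ} (hθ : 0 < θ) (hL : 0 ≤ L) (hμ₀ : 0 < μ₀)
    (hn : 1 ≤ n) (hlamL : lam ≤ n * L) (hmu₀ : μ₀ ≤ mu) (hmuM : mu ≤ M)
    (hd : d ≤ mu * x) (hr : |r| ≤ R) (hy : y = (x - lam / mu) / √n - r) :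
    lam * (Real.exp (-(θ * (y + 1 / √n))) - Real.exp (-(θ * y))) +
      d * (Real.exp (-(θ * (y - 1 / √n))) - Real.exp (-(θ * y))) + Real.exp (-(θ * y)) ≤
      expDriftConst θ L M μ₀ R := by
  have hmu : 0 < mu := hμ₀.trans_le hmu₀
  have hM : 0 < M := hmu.trans_le hmuM
  have hs1 : 1 ≤ √n := Real.one_le_sqrt.2 hn
  have hs : 0 < √n := zero_lt_one.trans_le hs1
  have hsq : √n * √n = n := Real.mul_self_sqrt (by linarith)
  -- One jump multiplies `exp (-θ y)` by `exp (∓u)`.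
  set u := θ * (1 / √n) with hu
  have hu0 : 0 < u := by positivity
  have huθ : u ≤ θ := by
    rw [hu, mul_one_div]
    exact div_le_self hθ.le hs1
  have hus : √n * u = θ := by
    rw [hu]
    field_simp
  set a := (x - lam / mu) / √n with ha
  have hmux : mu * x = lam + mu * √n * a := by
    rw [ha]
    field_simp
    ring
  set E := Real.exp (-(θ * y)) with hE
  have hE0 : 0 < E := Real.exp_pos _
  have hup : Real.exp (-(θ * (y + 1 / √n))) = E * Real.exp (-u) := by
    rw [hE, ← Real.exp_add, hu]
    ring_nf
  have hdown : Real.exp (-(θ * (y - 1 / √n))) = E * Real.exp u := by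
    rw [hE, ← Real.exp_add, hu]
    ring_nf
  have hexpu : Real.exp u ≤ Real.exp θ := Real.exp_le_exp.2 huθ
  have hinv : Real.exp u * Real.exp (-u) = 1 := by rw [← Real.exp_add]; simp
  have h1u : 1 - Real.exp (-u) ≤ u := by linarith [Real.add_one_le_exp (-u)]
  have h1u0 : 0 ≤ 1 - Real.exp (-u) := by simpa using hu0.le
  have hκ1 : θ ≤ √n * (Real.exp u - 1) := by
    rw [← hus]
    exact mul_le_mul_of_nonneg_left (by linarith [Real.add_one_le_exp u]) hs.le
  have hκ2 : √n * (Real.exp u - 1) ≤ θ * Real.exp θ := by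
    have h2 : Real.exp u - 1 ≤ u * Real.exp u := by
      nlinarith [mul_le_mul_of_nonneg_left h1u (Real.exp_pos u).le]
    calc √n * (Real.exp u - 1) ≤ √n * (u * Real.exp u) := mul_le_mul_of_nonneg_left h2 hs.le
      _ = θ * Real.exp u := by rw [← mul_assoc, hus]
      _ ≤ θ * Real.exp θ := mul_le_mul_of_nonneg_left hexpu hθ.le
  -- The second difference is of order `u² = θ²/n`, which compensates an arrival rate of order `n`.
  have hA : lam * (Real.exp u + Real.exp (-u) - 2) ≤ L * θ ^ 2 * Real.exp θ := by
    have h2 : Real.exp u + Real.exp (-u) - 2 = Real.exp u * (1 - Real.exp (-u)) ^ 2 := by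
      linear_combination (Real.exp (-u) - 2) * (-hinv)
    have h3 : (1 - Real.exp (-u)) ^ 2 ≤ u ^ 2 := pow_le_pow_left₀ h1u0 h1u 2
    rw [h2]
    calc lam * (Real.exp u * (1 - Real.exp (-u)) ^ 2) ≤ (n * L) * (Real.exp θ * u ^ 2) := by
          gcongr
      _ = L * (√n * u) ^ 2 * Real.exp θ := by
          linear_combination (-(L * Real.exp θ * u ^ 2)) * hsq
      _ = _ := by rw [hus]
  set A := L * θ ^ 2 * Real.exp θ with hAdef
  have hA0 : 0 ≤ A := by positivity
  -- Insert `d ≤ μ x = λ + μ √n a`; an upper bound on `d` suffices since `exp u - 1 ≥ 0`. The `λ`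
  -- terms combine into the second difference, and the restoring term in `a` remains.
  have hB : lam * (Real.exp (-u) - 1) + d * (Real.exp u - 1) + 1 ≤
      A + 1 + mu * a * (√n * (Real.exp u - 1)) := by
    have h2 : 0 ≤ Real.exp u - 1 := by simpa using hu0.le
    have h3 : d * (Real.exp u - 1) ≤ (lam + mu * √n * a) * (Real.exp u - 1) :=
      mul_le_mul_of_nonneg_right (hd.trans hmux.le) h2
    linarith
  rw [hup, hdown]
  have hfac : lam * (E * Real.exp (-u) - E) + d * (E * Real.exp u - E) + E =
      E * (lam * (Real.exp (-u) - 1) + d * (Real.exp u - 1) + 1) := by ring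
  rw [hfac]
  refine (mul_le_mul_of_nonneg_left hB hE0.le).trans ?_
  set B := A + 1 + mu * a * (√n * (Real.exp u - 1)) with hBdef
  have hC0 := expDriftConst_nonneg (θ := θ) hL hM.le μ₀ R
  rcases le_or_gt B 0 with hB0 | hB0
  · exact (mul_nonpos_of_nonneg_of_nonpos hE0.le hB0).trans hC0
  -- `y = a - r`, so the shift by the spare capacity costs at most a factor `exp (θ R)`.
  have hER : E ≤ Real.exp (θ * R) * Real.exp (-(θ * a)) := by
    rw [hE, ← Real.exp_add, Real.exp_le_exp, hy]
    have : θ * r ≤ θ * R := mul_le_mul_of_nonneg_left ((le_abs_self r).trans hr) hθ.le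
    linarith
  have hmain : Real.exp (-(θ * a)) * B ≤ (A + 1 + M * Real.exp θ) * Real.exp ((A + 1) / μ₀) :=
    exp_neg_mul_affine_le hθ hA0 hμ₀ hmu₀ hmuM hκ1 hκ2 hB0
  calc E * B ≤ Real.exp (θ * R) * Real.exp (-(θ * a)) * B := by gcongr
    _ = Real.exp (θ * R) * (Real.exp (-(θ * a)) * B) := by ring
    _ ≤ Real.exp (θ * R) * ((A + 1 + M * Real.exp θ) * Real.exp ((A + 1) / μ₀)) := by gcongr
    _ = expDriftConst θ L M μ₀ R := by
      rw [expDriftConst]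
      ring

/-- The generator on functions of a single coordinate. -/
theorem generator_coordinate {lam mu gam : Fin m → ℝ} {z : (Fin m → ℕ) → Fin m → ℕ}
    (hz : ∀ x i, z x i ≤ x i) (f : ℝ → ℝ) (i : Fin m) (x : Fin m → ℕ) :
    generator lam mu gam z (fun x => f (x i)) x =
      lam i * (f (x i + 1) - f (x i)) + departureRate mu gam z x i * (f (x i - 1) - f (x i)) := by
  rw [generator]
  congr 1
  · rw [Finset.sum_eq_single i]
    · simp
    · intro j _ hj
      simp [hj.symm]
    · simp
  · rw [Finset.sum_eq_single i]
    · by_cases hx : x i = 0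
      · simp [departureRate_eq_zero hz hx]
      · simp [Nat.cast_sub (Nat.one_le_iff_ne_zero.2 hx)]
    · intro j _ hj
      simp [hj.symm]
    · simp

/-- Slow abandonment enters here: `gam ≤ mu` bounds the departure rate by `μ x` for every policy,
which makes the constant independent of `z`. -/
theorem lintegral_exp_neg_scaledState_le {lam mu gam : ℕ → Fin m → ℝ} {n : ℕ}
    {z : (Fin m → ℕ) → Fin m → ℕ} {i : Fin m} {θ L M μ₀ R : ℝ} (hθ : 0 < θ) (hL : 0 ≤ L)
    (hμ₀ : 0 < μ₀) (hn : 1 ≤ n) (hlam : ∀ j, 0 ≤ lam n j) (hmu : ∀ j, 0 ≤ mu n j)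
    (hgam : ∀ j, 0 ≤ gam n j) (hlamL : lam n i ≤ n * L) (hmu₀ : μ₀ ≤ mu n i) (hmuM : mu n i ≤ M)
    (hgammu : gam n i ≤ mu n i) (hR : |spareCapacity lam mu n / m| ≤ R) (hz : WorkConserving n z)
    {π : Measure (Fin m → ℕ)} (hπ : IsInvariant (jumpRate (lam n) (mu n) (gam n) z) π) :
    ∫⁻ x, ENNReal.ofReal (Real.exp (-(θ * scaledState lam mu n x i))) ∂π ≤
      ENNReal.ofReal (expDriftConst θ L M μ₀ R) := by
  have hz' := hz.le_state
  have hM : 0 ≤ M := hμ₀.le.trans (hmu₀.trans hmuM)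
  refine hπ.lintegral_le (exitRate_jumpRate_ne_top hlam hmu hgam hz')
    (V := fun x => Real.exp (-(θ * scaledState lam mu n x i))) (fun x => (Real.exp_pos _).le)
    (expDriftConst_nonneg hL hM μ₀ R) fun x => ?_
  refine drift_of_generator_le hlam hmu hgam hz' (fun x => (Real.exp_pos _).le)
    (Real.exp_pos _).le ?_
  have hgen := generator_coordinate (lam := lam n) (mu := mu n) (gam := gam n) hz'
    (fun s => Real.exp (-(θ * ((s - lam n i / mu n i) / √n - spareCapacity lam mu n / m)))) i x
  have hplus : ((x i : ℝ) + 1 - lam n i / mu n i) / √n - spareCapacity lam mu n / m =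
      scaledState lam mu n x i + 1 / √n := by
    rw [scaledState]
    ring
  have hminus : ((x i : ℝ) - 1 - lam n i / mu n i) / √n - spareCapacity lam mu n / m =
      scaledState lam mu n x i - 1 / √n := by
    rw [scaledState]
    ring
  rw [hplus, hminus] at hgen
  refine (add_le_add hgen.le le_rfl).trans (exp_drift_le hθ hL hμ₀ (by exact_mod_cast hn)
    hlamL hmu₀ hmuM ?_ hR rfl)
  have h1 : (z x i : ℝ) ≤ x i := by exact_mod_cast hz' x i
  unfold departureRate
  nlinarith [mul_le_mul_of_nonneg_right hgammu (sub_nonneg.2 h1)]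

/-- At most `m` terms sum to at most `m` times the largest, which is `0` or some `-(y k)`. No joint
information on the classes is needed. -/
theorem expNegPart_le {η : ℝ} (hη : 0 ≤ η) (I : Finset (Fin m)) (y : Fin m → ℝ) :
    expNegPart η I y ≤ 1 + ∑ i ∈ I, Real.exp (-(m * η * y i)) := by
  rcases I.eq_empty_or_nonempty with rfl | hI
  · simp [expNegPart]
  obtain ⟨k, hk, hmax⟩ := I.exists_max_image (fun i => max (-(y i)) 0) hI
  have hsum : ∑ i ∈ I, max (-(y i)) 0 ≤ m * max (-(y k)) 0 := by
    calc ∑ i ∈ I, max (-(y i)) 0 ≤ I.card * max (-(y k)) 0 := by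
          simpa using Finset.sum_le_card_nsmul I _ _ hmax
      _ ≤ _ := by
          gcongr
          simpa using I.card_le_univ
  have hexp : expNegPart η I y ≤ Real.exp (m * η * max (-(y k)) 0) := by
    rw [expNegPart, Real.exp_le_exp]
    calc η * ∑ i ∈ I, max (-(y i)) 0 ≤ η * (m * max (-(y k)) 0) := by gcongr
      _ = _ := by ring
  have hnn : 0 ≤ ∑ i ∈ I, Real.exp (-(m * η * y i)) := Finset.sum_nonneg fun i _ => by positivity
  have hk' := Finset.single_le_sum (f := fun i => Real.exp (-(m * η * y i)))
    (fun i _ => (Real.exp_pos _).le) hk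
  refine hexp.trans ?_
  rcases le_total (-(y k)) 0 with h | h
  · rw [max_eq_right h]
    simpa using hnn
  · rw [max_eq_left h, mul_neg]
    linarith

theorem measurable_expNegPart (η : ℝ) (I : Finset (Fin m)) : Measurable (expNegPart η I) := by
  unfold expNegPart
  fun_prop

theorem integrable_map_and_integral_le {S E : Type*} [MeasurableSpace S] [MeasurableSpace E]
    {π : Measure S} {g : S → E} (hg : Measurable g) {f : E → ℝ} (hf : Measurable f)
    (hf0 : ∀ y, 0 ≤ f y) {C : ℝ} (hC : 0 ≤ C)
    (h : ∫⁻ x, ENNReal.ofReal (f (g x)) ∂π ≤ ENNReal.ofReal C) :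
    Integrable f (π.map g) ∧ ∫ y, f y ∂(π.map g) ≤ C := by
  rw [← lintegral_map (f := fun y => ENNReal.ofReal (f y)) hf.ennreal_ofReal hg] at h
  refine ⟨⟨hf.aestronglyMeasurable, ?_⟩, ?_⟩
  · rw [hasFiniteIntegral_iff_ofReal (ae_of_all _ hf0)]
    exact h.trans_lt ENNReal.ofReal_lt_top
  · rw [integral_eq_lintegral_of_nonneg_ae (ae_of_all _ hf0) hf.aestronglyMeasurable]
    exact ENNReal.toReal_le_of_le_ofReal hC h

/-! ### The Halfin--Whitt regime -/

namespace HalfinWhitt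

variable {lam mu gam : ℕ → Fin m → ℝ} {lamLim muLim gamLim lamHat muHat : Fin m → ℝ}

/-- `load_sum` replaces the `1` by `∑ λ_i/μ_i`, so each class contributes a combination of its two
`√n`-centred rates. Convergence is used to bound the shift in the scaled state. -/
theorem tendsto_spareCapacity (h : HalfinWhitt lam mu gam lamLim muLim gamLim lamHat muHat) :
    Tendsto (spareCapacity lam mu) atTop
      (𝓝 (∑ i, (lamLim i * muHat i - muLim i * lamHat i) / (muLim i * muLim i))) := by
  have hlim : ∀ i, Tendsto (fun n : ℕ => (lamLim i * (√n * (mu n i - muLim i)) -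
      muLim i * ((lam n i - n * lamLim i) / √n)) / (muLim i * mu n i)) atTop
      (𝓝 ((lamLim i * muHat i - muLim i * lamHat i) / (muLim i * muLim i))) := fun i =>
    (((h.tendsto_muHat i).const_mul _).sub ((h.tendsto_lamHat i).const_mul _)).div
      ((h.tendsto_mu i).const_mul _) (mul_ne_zero (h.muLim_pos i).ne' (h.muLim_pos i).ne')
  refine (tendsto_finsetSum Finset.univ fun i _ => hlim i).congr' ?_
  have hpos : ∀ᶠ n in atTop, ∀ i, 0 < mu n i := eventually_all.2 fun i =>
    (h.tendsto_mu i).eventually (lt_mem_nhds (h.muLim_pos i))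
  filter_upwards [hpos, eventually_ge_atTop 1] with n hmu hn
  have hs : 0 < √(n : ℝ) := Real.sqrt_pos.2 (by exact_mod_cast hn)
  rw [spareCapacity, ← h.load_sum, ← Finset.sum_sub_distrib, Finset.mul_sum]
  refine Finset.sum_congr rfl fun i _ => ?_
  have h1 := hmu i
  have h2 := h.muLim_pos i
  have hsq : (n : ℝ) = √(n : ℝ) * √(n : ℝ) := (Real.mul_self_sqrt (Nat.cast_nonneg n)).symm
  generalize √(n : ℝ) = s at hs hsq ⊢
  rw [hsq]
  field_simp
  ring

theorem eventually_gam_le (h : HalfinWhitt lam mu gam lamLim muLim gamLim lamHat muHat) {i : Fin m}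
    (hi : i ∈ slowAbandonment mu gam) : ∀ᶠ n in atTop, gam n i ≤ mu n i := by
  have hlim : Tendsto (fun n : ℕ => gam n i / mu n i) atTop (𝓝 (gamLim i / muLim i)) :=
    (h.tendsto_gam i).div (h.tendsto_mu i) (h.muLim_pos i).ne'
  have hlt : gamLim i / muLim i < 1 := by
    rw [← hlim.limsup_eq]
    simpa [slowAbandonment] using hi
  filter_upwards [hlim.eventually (gt_mem_nhds hlt),
    (h.tendsto_mu i).eventually (lt_mem_nhds (h.muLim_pos i))] with n h1 h2
  rw [div_lt_one h2] at h1
  exact h1.le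

/-- The uniform bounds on the rates of the `n`-th system which hold for large `n`. -/
theorem eventually_bounds (h : HalfinWhitt lam mu gam lamLim muLim gamLim lamHat muHat) :
    ∃ R : ℝ, ∀ᶠ n : ℕ in atTop, |spareCapacity lam mu n / m| ≤ R ∧
      (∀ i, 0 < lam n i ∧ lam n i ≤ n * (lamLim i + 1) ∧ muLim i / 2 ≤ mu n i ∧
        mu n i ≤ muLim i + 1) ∧
      ∀ i ∈ slowAbandonment mu gam, gam n i ≤ mu n i := by
  obtain ⟨R, hR⟩ := (h.tendsto_spareCapacity.div_const (m : ℝ)).abs.isBoundedUnder_le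
  refine ⟨R, (eventually_map.1 hR).and ((eventually_all.2 fun i => ?_).and
    ((Filter.eventually_all_finset _).2 fun i hi => h.eventually_gam_le hi))⟩
  filter_upwards [(h.tendsto_lam i).eventually (lt_mem_nhds (h.lamLim_pos i)),
    (h.tendsto_lam i).eventually (gt_mem_nhds (lt_add_one (lamLim i))),
    (h.tendsto_mu i).eventually (lt_mem_nhds (half_lt_self (h.muLim_pos i))),
    (h.tendsto_mu i).eventually (gt_mem_nhds (lt_add_one (muLim i))),
    eventually_gt_atTop 0] with n h1 h2 h3 h4 hn
  have hn' : (0 : ℝ) < n := by exact_mod_cast hn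
  rw [div_lt_iff₀ hn'] at h2
  exact ⟨(div_pos_iff_of_pos_right hn').1 h1, by linarith, h3.le, h4.le⟩

end HalfinWhitt

/-- Positive spare capacity is the stability condition required by Foster's criterion. -/
theorem sum_load_lt_of_spareCapacity_pos {lam mu : ℕ → Fin m → ℝ} {n : ℕ} (hn : 0 < n)
    (h : 0 < spareCapacity lam mu n) : ∑ i, lam n i / mu n i < n := by
  have hn' : (0 : ℝ) < n := by exact_mod_cast hn
  have h1 : ∑ i, lam n i / (n * mu n i) < 1 := by
    have := (pos_iff_pos_of_mul_pos h).1 (Real.sqrt_pos.2 hn')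
    linarith
  have h2 : ∑ i, lam n i / (n * mu n i) = (∑ i, lam n i / mu n i) / n := by
    rw [Finset.sum_div]
    exact Finset.sum_congr rfl fun i _ => by rw [div_div, mul_comm]
  rwa [h2, div_lt_one hn'] at h1

end MulticlassQueue

end

/-! ### Assembly of the theorem -/

open MarkovChain MulticlassQueue in
theorem theorem3p5 {m : ℕ} (lam mu gam : ℕ → Fin m → ℝ)
    (lamLim muLim gamLim lamHat muHat : Fin m → ℝ)
    (hHW : HalfinWhitt lam mu gam lamLim muLim gamLim lamHat muHat)
    (hspare : 0 < liminf (fun n : ℕ => spareCapacity lam mu n) atTop) :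
    ∃ n₀ : ℕ,
      (∀ n ≥ n₀, ∀ z : (Fin m → ℕ) → Fin m → ℕ, WorkConserving n z →
        ∃! π : Measure (Fin m → ℕ), IsInvariant (jumpRate (lam n) (mu n) (gam n) z) π) ∧
      (∀ η : ℝ, 0 < η → ∃ C : ℝ, ∀ n ≥ n₀, ∀ z : (Fin m → ℕ) → Fin m → ℕ, WorkConserving n z →
        ∀ π : Measure (Fin m → ℕ), IsInvariant (jumpRate (lam n) (mu n) (gam n) z) π →
          Integrable (expNegPart η (slowAbandonment mu gam)) (π.map (scaledState lam mu n)) ∧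
          ∫ y, expNegPart η (slowAbandonment mu gam) y ∂(π.map (scaledState lam mu n)) ≤ C) := by
  obtain ⟨R, hR⟩ := hHW.eventually_bounds
  have hpos : ∀ᶠ n : ℕ in atTop, 0 < spareCapacity lam mu n :=
    eventually_lt_of_lt_liminf hspare hHW.tendsto_spareCapacity.isBoundedUnder_ge
  -- The bounds on the rates do not involve `η`, so `n₀` is fixed before `η`; only `C` depends on
  -- it.
  obtain ⟨n₀, hn₀⟩ := eventually_atTop.1 ((hR.and hpos).and (eventually_gt_atTop 0))
  have hmu : ∀ n ≥ n₀, ∀ i, 0 < mu n i := fun n hn i =>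
    (half_pos (hHW.muLim_pos i)).trans_le (((hn₀ n hn).1.1.2.1 i).2.2.1)
  refine ⟨n₀, fun n hn z hz => ?_, fun η hη => ?_⟩
  · obtain ⟨⟨⟨-, hb, -⟩, hϱ⟩, hn0⟩ := hn₀ n hn
    exact existsUnique_isInvariant (fun i => (hb i).1) (hmu n hn) (hHW.gam_nonneg n)
      (sum_load_lt_of_spareCapacity_pos hn0 hϱ) hz
  · set C : Fin m → ℝ := fun i =>
      expDriftConst (m * η) (lamLim i + 1) (muLim i + 1) (muLim i / 2) R with hC
    have hC0 : ∀ i, 0 ≤ C i := fun i => expDriftConst_nonneg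
      (add_nonneg (hHW.lamLim_pos i).le zero_le_one) (add_nonneg (hHW.muLim_pos i).le zero_le_one)
      _ _
    have hCsum : 0 ≤ ∑ i ∈ slowAbandonment mu gam, C i := Finset.sum_nonneg fun i _ => hC0 i
    refine ⟨1 + ∑ i ∈ slowAbandonment mu gam, C i, fun n hn z hz π hπ => ?_⟩
    obtain ⟨⟨⟨hRn, hb, hg⟩, -⟩, hn0⟩ := hn₀ n hn
    have := hπ.prob
    refine integrable_map_and_integral_le (measurable_of_countable _) (measurable_expNegPart _ _)
      (fun y => (Real.exp_pos _).le) (add_nonneg zero_le_one hCsum) ?_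
    calc ∫⁻ x, ENNReal.ofReal (expNegPart η (slowAbandonment mu gam) (scaledState lam mu n x)) ∂π
        ≤ ∫⁻ x, (1 + ∑ i ∈ slowAbandonment mu gam,
            ENNReal.ofReal (Real.exp (-(m * η * scaledState lam mu n x i)))) ∂π := by
          refine lintegral_mono fun x => (ENNReal.ofReal_le_ofReal (expNegPart_le hη.le _ _)).trans ?_
          rw [ENNReal.ofReal_add zero_le_one (Finset.sum_nonneg fun i _ => (Real.exp_pos _).le),
            ENNReal.ofReal_one, ENNReal.ofReal_sum_of_nonneg fun i _ => (Real.exp_pos _).le]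
      _ = 1 + ∑ i ∈ slowAbandonment mu gam,
            ∫⁻ x, ENNReal.ofReal (Real.exp (-(m * η * scaledState lam mu n x i))) ∂π := by
          rw [lintegral_add_left measurable_const,
            lintegral_finsetSum _ fun i _ => measurable_of_countable _]
          simp
      _ ≤ 1 + ∑ i ∈ slowAbandonment mu gam, ENNReal.ofReal (C i) := by
          gcongr with i hi
          -- An index in `Fin m` forces `m > 0`, so the exponent `m η` is positive.
          have hm : (0 : ℝ) < m := by exact_mod_cast i.pos
          exact lintegral_exp_neg_scaledState_le (mul_pos hm hη)
            (add_nonneg (hHW.lamLim_pos i).le zero_le_one) (half_pos (hHW.muLim_pos i)) hn0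
            (fun j => (hb j).1.le) (fun j => (hmu n hn j).le) (hHW.gam_nonneg n) (hb i).2.1
            (hb i).2.2.1 (hb i).2.2.2 (hg i hi) hRn hz hπ
      _ = ENNReal.ofReal (1 + ∑ i ∈ slowAbandonment mu gam, C i) := by
          rw [ENNReal.ofReal_add zero_le_one hCsum, ENNReal.ofReal_one,
            ENNReal.ofReal_sum_of_nonneg fun i _ => hC0 i]
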